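/- Let $n\in\mathbb N$, $p>1$, and let $d\ge 1$ be an integer with $dp\ge \log_2 9$. For $x\in\mathbb R^n$, $t\in\mathbb R$, $L>0$ and $0\le\gamma\le 1/2$, the parabolic rectangle with these data is $$R(\gamma)=R(x,t,L,\gamma)=Q(x,L)\times[t-L^p,\,t-\gamma L^p)\subseteq\mathbb R^{n+1},$$ where $Q(x,L)$ is the half-open cube with centre $x$ and side length $L$. Put $l_x(R(\gamma))=L$, $l_t(R(\gamma))=(1-\gamma)L^p$, and $R^\theta(\gamma)=R(\gamma)+(0,\theta\, l_t(R(\gamma)))$ for $\theta\in\mathbb R$. The layer $\mathcal D_1(R(\gamma))$ consists of the rectangles obtained by dividing each spatial edge of $R(\gamma)$ into $2^d$ equal parts and the temporal edge into $k$ equal parts, where $k=\lceil 2^{dp}\rceil$ if $\gamma\le 1-\frac{2^{dp}+1}{2^{dp+1}}$ and $k=\lfloor 2^{dp}\rfloor$ otherwise; these are again parabolic rectangles with truncation parameter in $[0,1/2]$. Let $\mathcal D_0(R(\gamma))=\{R(\gamma)\}$, $\mathcal D_{i+1}(R(\gamma))=\bigcup_{P\in\mathcal D_i(R(\gamma))}\mathcal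 D_1(P)$ and $\mathcal D(R(\gamma))=\bigcup_{i\ge 0}\mathcal D_i(R(\gamma))$. For a nonempty closed set $E\subseteq\mathbb R^{n+1}$, a set is $E$-free if it is disjoint from $E$, and $\mathcal M(R(\gamma))$ denotes an $E$-free rectangle in $\mathcal D(R(\gamma))$ of largest side length $l_x$ (and $\mathcal M(R(\gamma))=\emptyset$ if there is no $E$-free rectangle in $\mathcal D(R(\gamma))$). For $c,\delta\in(0,1)$ and $\theta\in\mathbb R$, a nonempty closed set $E$ is $(c,\delta,\theta)$-weakly porous if for every parabolic rectangle $R(\gamma_0)$ with $0\le\gamma_0\le 1/2$ there are finitely many pairwise disjoint $E$-free rectangles $P_1,\dots,P_N\in\mathcal D(R(\gamma_0))$ with $|P_k|\ge\delta\,|\mathcal M(R^\theta(\gamma_0))|$ for every $k$ and $\sum_{k=1}^N|P_k|\ge c\,|R(\gamma_0)|$. A $(c_0,\delta_0,\theta)$-weakly porous set $E$ is $\alpha$-improving, for $\alpha>0$, if there is a constant $K>0$ such that for every $0<\delta\le\delta_0$ the set $E$ is $(c,\delta,\theta)$-weakly porous for some $0<c<1$ with $1-c\le K\delta^\alpha$.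 Fix integers $\theta_0,\phi,\Phi\ge 2$ such that $$\phi\le\Phi-\theta_0-\Big\lceil\tfrac{2\theta_0}{2^{dp}-1}\Big\rceil,\qquad \phi\le\theta_0\le\Phi,\qquad \Phi\ge\lceil 2^{dp}\rceil-1,$$ $$\phi\le\lfloor 2^{dp}\rfloor-1-\theta_0-\Big\lceil\tfrac{2\theta_0}{2^{dp}-1}\Big\rceil,\qquad \phi-\theta_0\le-\Big\lceil\tfrac{4\theta_0}{2^{dp}-1}\Big\rceil .$$ **Lemma.** Let $c_0,\delta_0\in(0,1)$. There is $\alpha>0$, depending only on $n,p,d,c_0,\delta_0$ (and the fixed parameters $\theta_0,\phi,\Phi$), such that every $(c_0,\delta_0,\Phi)$-weakly porous set $E\subseteq\mathbb R^{n+1}$ is $\alpha$-improving. -/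

import Mathlib

namespace Parabolic

open MeasureTheory

/-- Parameters `(x, t, L, γ)` of a truncated parabolic rectangle in `ℝⁿ × ℝ`. -/
structure Rect (n : ℕ) where
  /-- centre of the spatial cube -/
  x : Fin n → ℝ
  /-- upper end of the time interval before truncation -/
  t : ℝ
  /-- spatial side length -/
  L : ℝ
  /-- truncation parameter -/
  γ : ℝ

namespace Rect

variable {n : ℕ}

/-- The genuine truncated parabolic rectangles: positive side length and truncation parameter
in `[0, 1/2]`. -/
def Valid (R : Rect n) : Prop :=
  0 < R.L ∧ 0 ≤ R.γ ∧ R.γ ≤ 1 / 2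

/-- `R(x, t, L, γ) = Q(x, L) × [t - L ^ p, t - γ L ^ p)`, where `Q(x, L)` is the half-open cube
with centre `x` and side length `L`. -/
def toSet (p : ℝ) (R : Rect n) : Set ((Fin n → ℝ) × ℝ) :=
  (Set.univ.pi fun i => Set.Ico (R.x i - R.L / 2) (R.x i + R.L / 2)) ×ˢ
    Set.Ico (R.t - R.L ^ p) (R.t - R.γ * R.L ^ p)

/-- The temporal side length `(1 - γ) L ^ p`. -/
noncomputable def lt (p : ℝ) (R : Rect n) : ℝ :=
  (1 - R.γ) * R.L ^ p

/-- Lebesgue measure of a rectangle. -/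
noncomputable def vol (p : ℝ) (R : Rect n) : ℝ :=
  volume.real (R.toSet p)

/-- The translate of `R` by `θ` times its own temporal side length. -/
noncomputable def translate (p θ : ℝ) (R : Rect n) : Rect n :=
  { R with t := R.t + θ * R.lt p }

open Classical in
/-- Number of parts into which the temporal edge is divided. -/
noncomputable def timeDivisions (p : ℝ) (d : ℕ) (R : Rect n) : ℕ :=
  if R.γ ≤ 1 - ((2 : ℝ) ^ (d * p) + 1) / (2 : ℝ) ^ (d * p + 1) then
    ⌈(2 : ℝ) ^ (d * p)⌉₊
  else
    ⌊(2 : ℝ) ^ (d * p)⌋₊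

/-- The subrectangle of `R` in spatial position `j` and temporal position `m` (counted upwards)
when the spatial edges are divided into `2 ^ d` parts and the temporal edge into `timeDivisions`
parts. Its lower end in time is `R.t - R.L ^ p + m * (R.lt p / k)`, and its truncation parameter
is the one for which its temporal side length is `R.lt p / k`. -/
noncomputable def child (p : ℝ) (d : ℕ) (R : Rect n) (j : Fin n → Fin (2 ^ d)) (m : ℕ) :
    Rect n where
  x := fun i => R.x i - R.L / 2 + (((j i : ℕ) : ℝ) + 1 / 2) * (R.L / 2 ^ d)
  t := R.t - R.L ^ p + m * (R.lt p / R.timeDivisions p d) + (R.L / 2 ^ d) ^ p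
  L := R.L / 2 ^ d
  γ := 1 - (1 - R.γ) * (2 : ℝ) ^ (d * p) / R.timeDivisions p d

/-- The first dyadic layer of `R`. -/
def children (p : ℝ) (d : ℕ) (R : Rect n) : Set (Rect n) :=
  {P | ∃ j : Fin n → Fin (2 ^ d), ∃ m : ℕ, m < R.timeDivisions p d ∧ P = R.child p d j m}

/-- The dyadic layer of order `i` of `R`. -/
def dyadicLayer (p : ℝ) (d : ℕ) (R : Rect n) : ℕ → Set (Rect n)
  | 0 => {R}
  | i + 1 => ⋃ P ∈ dyadicLayer p d R i, P.children p d

/-- The dyadic lattice of `R`. -/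
def dyadicLattice (p : ℝ) (d : ℕ) (R : Rect n) : Set (Rect n) :=
  ⋃ i : ℕ, R.dyadicLayer p d i

end Rect

variable {n : ℕ}

/-- The dyadic subrectangles of `R` that are disjoint from `E`. -/
def freeRects (p : ℝ) (d : ℕ) (E : Set ((Fin n → ℝ) × ℝ)) (R : Rect n) : Set (Rect n) :=
  {P | P ∈ R.dyadicLattice p d ∧ Disjoint (P.toSet p) E}

/-- The maximal (with respect to inclusion) `E`-free dyadic subrectangles of `R`. -/
def maximalFreeRects (p : ℝ) (d : ℕ) (E : Set ((Fin n → ℝ) × ℝ)) (R : Rect n) :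
    Set (Rect n) :=
  {P | P ∈ freeRects p d E R ∧
    ∀ Q ∈ freeRects p d E R, P.toSet p ⊆ Q.toSet p → Q.toSet p ⊆ P.toSet p}

/-- `M` is a largest `E`-free dyadic subrectangle of `R`. -/
def IsLargestHole (p : ℝ) (d : ℕ) (E : Set ((Fin n → ℝ) × ℝ)) (R M : Rect n) : Prop :=
  M ∈ maximalFreeRects p d E R ∧ ∀ P ∈ maximalFreeRects p d E R, P.L ≤ M.L

open Classical in
/-- The maximal hole of `R`: a largest `E`-free dyadic subrectangle, as a set, or the empty set
if no dyadic subrectangle of `R` is `E`-free. Any two largest ones lie in the same dyadic layer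
and so have the same measure. -/
noncomputable def maximalHole (p : ℝ) (d : ℕ) (E : Set ((Fin n → ℝ) × ℝ)) (R : Rect n) :
    Set ((Fin n → ℝ) × ℝ) :=
  if h : ∃ M, IsLargestHole p d E R M then h.choose.toSet p else ∅

/-- `E` is `(c, δ, θ)`-weakly porous. -/
def IsWeaklyPorous (p : ℝ) (d : ℕ) (E : Set ((Fin n → ℝ) × ℝ)) (c δ θ : ℝ) : Prop :=
  E.Nonempty ∧ IsClosed E ∧ c ∈ Set.Ioo (0 : ℝ) 1 ∧ δ ∈ Set.Ioo (0 : ℝ) 1 ∧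
    ∀ R : Rect n, R.Valid →
      ∃ (N : ℕ) (P : Fin N → Rect n),
        (∀ k, P k ∈ R.dyadicLattice p d) ∧
        (Pairwise fun k l => Disjoint ((P k).toSet p) ((P l).toSet p)) ∧
        (∀ k, Disjoint ((P k).toSet p) E) ∧
        (∀ k, δ * volume.real (maximalHole p d E (R.translate p θ)) ≤ (P k).vol p) ∧
        c * R.vol p ≤ ∑ k, (P k).vol p

/-- `E`, being weakly porous with constants `(c₀, δ₀, θ)`, is `α`-improving. The definition does
not involve `c₀`. -/
def IsImproving (p : ℝ) (d : ℕ) (E : Set ((Fin n → ℝ) × ℝ)) (δ₀ θ α : ℝ) : Prop :=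
  0 < α ∧ ∃ K : ℝ, 0 < K ∧ ∀ δ : ℝ, 0 < δ → δ ≤ δ₀ →
    ∃ c ∈ Set.Ioo (0 : ℝ) 1, IsWeaklyPorous p d E c δ θ ∧ 1 - c ≤ K * δ ^ α

/-- The conditions on the integer translation parameters `θ₀, φ, Φ`. -/
structure TranslationParameters (p : ℝ) (d : ℕ) (θ₀ φ Φ : ℤ) : Prop where
  two_le_θ₀ : 2 ≤ θ₀
  two_le_φ : 2 ≤ φ
  two_le_Φ : 2 ≤ Φ
  cond₁ : φ ≤ Φ - θ₀ - ⌈2 * (θ₀ : ℝ) / ((2 : ℝ) ^ (d * p) - 1)⌉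
  cond₂ : φ ≤ θ₀ ∧ θ₀ ≤ Φ
  cond₃ : ⌈(2 : ℝ) ^ (d * p)⌉ - 1 ≤ Φ
  cond₄ : φ ≤ ⌊(2 : ℝ) ^ (d * p)⌋ - 1 - θ₀ - ⌈2 * (θ₀ : ℝ) / ((2 : ℝ) ^ (d * p) - 1)⌉
  cond₅ : φ - θ₀ ≤ -⌈4 * (θ₀ : ℝ) / ((2 : ℝ) ^ (d * p) - 1)⌉

end Parabolic

/-! ### Half-open boxes, nested space-time grids and free cells. -/

namespace Parabolic

open MeasureTheory Set

/-! All rectangles of one dyadic layer share their truncation parameter, so a layer is a piece of a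
regular grid with side lengths `l i` and `τ i`. In this language weak porosity becomes `Porous`: a
free cell in the translate of a box by Φ time lengths forces slightly finer free cells to fill a
portion c of the box.

Holes flow backwards in time (`exists_flow`). Two boxes that differ by a small enough spatial shift
overlap in more than the portion 1 - c that porosity leaves uncontrolled, so each use of porosity
can move a hole sideways as well as back. A box q levels finer leaves room for about 2 ^ (d p q)
such moves in time, while the spatial distance asks for about 2 ^ (d q); as p > 1, the first wins
for a suitable fixed q. Hence a hole ahead of a box yields a hole, at most M levels deeper, ahead of
every cell inside it (`Flows.holeAfter`).

Next, a stopping argument (`Porous.exists_cell`) places within bounded relative time distance of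
each uncovered point a cell free of old holes, of which new holes fill a portion c. Disjoint maximal
such cells, prolonged backwards in time, cover the uncovered set, so the new holes have measure
comparable to it (`Porous.generation`). Iteration makes the uncovered part decay like ρ ^ N while
the holes sink only M + m levels per generation (`Porous.decay`), which reduces their volume by at
most a factor B each time. Comparing the two geometric rates gives α = -log ρ / log B
(`exists_division`), and ρ and B are fixed before E. -/

/-- The half-open box with lower corner `a` and upper corner `b`. -/
def prism {n : ℕ} (a b : (Fin n → ℝ) × ℝ) : Set ((Fin n → ℝ) × ℝ) :=
  (univ.pi fun c => Ico (a.1 c) (b.1 c)) ×ˢ Ico a.2 b.2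

theorem mem_prism {n : ℕ} {a b z : (Fin n → ℝ) × ℝ} :
    z ∈ prism a b ↔ (∀ c, a.1 c ≤ z.1 c ∧ z.1 c < b.1 c) ∧ a.2 ≤ z.2 ∧ z.2 < b.2 := by
  simp [prism, Set.mem_prod, Set.mem_pi]

theorem measurableSet_prism {n : ℕ} (a b : (Fin n → ℝ) × ℝ) : MeasurableSet (prism a b) :=
  (MeasurableSet.univ_pi fun _ => measurableSet_Ico).prod measurableSet_Ico

theorem volume_prism {n : ℕ} {a b : (Fin n → ℝ) × ℝ} (h : a ≤ b) :
    volume (prism a b) = ENNReal.ofReal ((∏ c, (b.1 c - a.1 c)) * (b.2 - a.2)) := by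
  rw [prism, Measure.volume_eq_prod, Measure.prod_prod, Real.volume_pi_Ico, Real.volume_Ico,
    ← ENNReal.ofReal_prod_of_nonneg fun c _ => sub_nonneg.2 (h.1 c),
    ← ENNReal.ofReal_mul (Finset.prod_nonneg fun c _ => sub_nonneg.2 (h.1 c))]

theorem volume_prism_ne_top {n : ℕ} (a b : (Fin n → ℝ) × ℝ) : volume (prism a b) ≠ ⊤ := by
  rw [prism, Measure.volume_eq_prod, Measure.prod_prod, Real.volume_pi_Ico, Real.volume_Ico]
  exact ENNReal.mul_ne_top (ENNReal.prod_ne_top fun _ _ => ENNReal.ofReal_ne_top)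
    ENNReal.ofReal_ne_top

theorem volume_real_prism {n : ℕ} {a b : (Fin n → ℝ) × ℝ} (h : a ≤ b) :
    volume.real (prism a b) = (∏ c, (b.1 c - a.1 c)) * (b.2 - a.2) := by
  rw [Measure.real, volume_prism h, ENNReal.toReal_ofReal]
  exact mul_nonneg (Finset.prod_nonneg fun c _ => sub_nonneg.2 (h.1 c)) (sub_nonneg.2 h.2)

/-- Side lengths of the layers of a parabolic dyadic lattice: level `i` has spatial side length
`l i` and temporal side length `τ i`. -/
structure Scales (p : ℝ) (d K : ℕ) where
  l : ℕ → ℝ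
  τ : ℕ → ℝ
  k : ℕ → ℕ
  l_pos : ∀ i, 0 < l i
  τ_pos : ∀ i, 0 < τ i
  l_succ : ∀ i, l i = (2 ^ d : ℕ) * l (i + 1)
  τ_succ : ∀ i, τ i = k i * τ (i + 1)
  nine_le : ∀ i, 9 ≤ k i
  k_le : ∀ i, k i ≤ K
  le_τ : ∀ i, l i ^ p / 2 ≤ τ i
  τ_le : ∀ i, τ i ≤ l i ^ p

namespace Scales

variable {p : ℝ} {d K n : ℕ} (σ : Scales p d K)

theorem l_add (i q : ℕ) : σ.l i = (2 ^ (d * q) : ℕ) * σ.l (i + q) := by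
  induction q with
  | zero => simp
  | succ q ih =>
    rw [ih, σ.l_succ (i + q), ← add_assoc, ← mul_assoc, Nat.mul_succ, pow_add]
    push_cast; rfl

theorem τ_add (i q : ℕ) : ∃ N : ℕ, 9 ^ q ≤ N ∧ N ≤ K ^ q ∧ σ.τ i = N * σ.τ (i + q) := by
  induction q with
  | zero => exact ⟨1, by simp⟩
  | succ q ih =>
    obtain ⟨N, h₁, h₂, h₃⟩ := ih
    refine ⟨N * σ.k (i + q), ?_, ?_, ?_⟩
    · rw [pow_succ]; exact Nat.mul_le_mul h₁ (σ.nine_le _)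
    · rw [pow_succ]; exact Nat.mul_le_mul h₂ (σ.k_le _)
    · rw [h₃, σ.τ_succ (i + q), ← add_assoc]; push_cast; ring

theorem l_of_le {i j : ℕ} (h : i ≤ j) : ∃ N : ℕ, 0 < N ∧ σ.l i = N * σ.l j := by
  obtain ⟨q, rfl⟩ := Nat.exists_eq_add_of_le h
  exact ⟨_, by positivity, σ.l_add i q⟩

theorem τ_of_le {i j : ℕ} (h : i ≤ j) : ∃ N : ℕ, 0 < N ∧ σ.τ i = N * σ.τ j := by
  obtain ⟨q, rfl⟩ := Nat.exists_eq_add_of_le h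
  obtain ⟨N, h₁, -, h₃⟩ := σ.τ_add i q
  exact ⟨N, lt_of_lt_of_le (by positivity) h₁, h₃⟩

theorem τ_anti : Antitone σ.τ := fun i j h => by
  obtain ⟨N, h₁, h₂⟩ := σ.τ_of_le h
  have : (1 : ℝ) ≤ N := by exact_mod_cast h₁
  rw [h₂]; nlinarith [σ.τ_pos j]

theorem l_anti : Antitone σ.l := fun i j h => by
  obtain ⟨N, h₁, h₂⟩ := σ.l_of_le h
  have : (1 : ℝ) ≤ N := by exact_mod_cast h₁
  rw [h₂]; nlinarith [σ.l_pos j]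

theorem nine_mul_τ_succ_le (i : ℕ) : 9 * σ.τ (i + 1) ≤ σ.τ i := by
  rw [σ.τ_succ i]
  have : (9 : ℝ) ≤ σ.k i := by exact_mod_cast σ.nine_le i
  exact mul_le_mul_of_nonneg_right this (σ.τ_pos _).le

/-- Index of the level `i` cell containing `z`, in the grid with origin `o`. -/
noncomputable def index (o : (Fin n → ℝ) × ℝ) (i : ℕ) (z : (Fin n → ℝ) × ℝ) :
    (Fin n → ℤ) × ℤ :=
  (fun c => ⌊(z.1 c - o.1 c) / σ.l i⌋, ⌊(z.2 - o.2) / σ.τ i⌋)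

/-- Lower corner of the level `i` cell with index `v`. -/
noncomputable def node (o : (Fin n → ℝ) × ℝ) (i : ℕ) (v : (Fin n → ℤ) × ℤ) : (Fin n → ℝ) × ℝ :=
  (fun c => o.1 c + v.1 c * σ.l i, o.2 + v.2 * σ.τ i)

/-- The box of level `i` with lower corner `o`. -/
noncomputable def box (o : (Fin n → ℝ) × ℝ) (i : ℕ) : Set ((Fin n → ℝ) × ℝ) :=
  prism o (fun c => o.1 c + σ.l i, o.2 + σ.τ i)

/-- The translate of a point in time. -/
def later (o : (Fin n → ℝ) × ℝ) (s : ℝ) : (Fin n → ℝ) × ℝ := (o.1, o.2 + s)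

/-- The level `i` cell of `z` in the grid with origin `o` does not meet `E`. -/
def IsFree (E : Set ((Fin n → ℝ) × ℝ)) (o : (Fin n → ℝ) × ℝ) (i : ℕ) (z : (Fin n → ℝ) × ℝ) :
    Prop :=
  ∀ w ∈ E, σ.index o i w ≠ σ.index o i z

theorem mem_box {o z : (Fin n → ℝ) × ℝ} {i : ℕ} : z ∈ σ.box o i ↔
    (∀ c, o.1 c ≤ z.1 c ∧ z.1 c < o.1 c + σ.l i) ∧ o.2 ≤ z.2 ∧ z.2 < o.2 + σ.τ i :=
  mem_prism

theorem mem_cell {o z : (Fin n → ℝ) × ℝ} {i : ℕ} {v : (Fin n → ℤ) × ℤ} :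
    z ∈ σ.box (σ.node o i v) i ↔ σ.index o i z = v := by
  have aux : ∀ (x y s : ℝ) (a : ℤ), 0 < s → ((y + a * s ≤ x ∧ x < y + a * s + s) ↔
      ⌊(x - y) / s⌋ = a) := by
    intro x y s a hs
    rw [Int.floor_eq_iff, le_div_iff₀ hs, div_lt_iff₀ hs]
    constructor <;> rintro ⟨h₁, h₂⟩ <;> constructor <;> linarith
  simp only [mem_box, node, aux _ _ _ _ (σ.l_pos i), aux _ _ _ _ (σ.τ_pos i), index, Prod.ext_iff,
    funext_iff]

theorem mem_cell_self (o z : (Fin n → ℝ) × ℝ) (i : ℕ) :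
    z ∈ σ.box (σ.node o i (σ.index o i z)) i := σ.mem_cell.2 rfl

theorem measurableSet_box (o : (Fin n → ℝ) × ℝ) (i : ℕ) : MeasurableSet (σ.box o i) :=
  measurableSet_prism _ _

theorem volume_box_ne_top (o : (Fin n → ℝ) × ℝ) (i : ℕ) : volume (σ.box o i) ≠ ⊤ :=
  volume_prism_ne_top _ _

theorem volume_real_box (o : (Fin n → ℝ) × ℝ) (i : ℕ) :
    volume.real (σ.box o i) = σ.l i ^ n * σ.τ i := by
  rw [box, volume_real_prism]
  · simp
  · exact ⟨fun c => by simpa using (σ.l_pos i).le, by simpa using (σ.τ_pos i).le⟩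

theorem volume_real_box_pos (o : (Fin n → ℝ) × ℝ) (i : ℕ) : 0 < volume.real (σ.box o i) := by
  rw [volume_real_box]
  exact mul_pos (pow_pos (σ.l_pos i) n) (σ.τ_pos i)

theorem measurable_index (o : (Fin n → ℝ) × ℝ) (i : ℕ) : Measurable (σ.index o i) := by
  unfold index
  refine Measurable.prodMk (measurable_pi_lambda _ fun c => ?_) ?_
  · exact Int.measurable_floor.comp (by fun_prop)
  · exact Int.measurable_floor.comp (by fun_prop)

/-- The free set is a preimage under an index map with countable range, so nothing is asked of `E`.
-/
theorem measurableSet_isFree (E : Set ((Fin n → ℝ) × ℝ)) (o : (Fin n → ℝ) × ℝ) (i : ℕ) :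
    MeasurableSet {z | σ.IsFree E o i z} :=
  σ.measurable_index o i (Set.to_countable {v | ∀ w ∈ E, σ.index o i w ≠ v}).measurableSet

/-- A coarse index is the integer quotient of a fine one. This makes the grids nested, although the
number of parts may vary between levels. -/
theorem floor_coarsen {x y s t : ℝ} {N : ℕ} (hst : s = N * t)
    (h : ⌊x / t⌋ = ⌊y / t⌋) : ⌊x / s⌋ = ⌊y / s⌋ := by
  rw [hst, mul_comm, ← div_div, ← div_div, Int.floor_div_natCast, Int.floor_div_natCast, h]

theorem index_coarsen {o z w : (Fin n → ℝ) × ℝ} {i j : ℕ} (hij : i ≤ j)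
    (h : σ.index o j z = σ.index o j w) : σ.index o i z = σ.index o i w := by
  obtain ⟨N, -, hN⟩ := σ.l_of_le hij
  obtain ⟨M, -, hM⟩ := σ.τ_of_le hij
  simp only [index, Prod.ext_iff, funext_iff] at h ⊢
  exact ⟨fun c => floor_coarsen hN (h.1 c), floor_coarsen hM h.2⟩

theorem IsFree.mono {E : Set ((Fin n → ℝ) × ℝ)} {o z : (Fin n → ℝ) × ℝ} {i j : ℕ}
    (h : σ.IsFree E o i z) (hij : i ≤ j) : σ.IsFree E o j z :=
  fun w hw e => h w hw (σ.index_coarsen hij e)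

theorem isFree_congr {E : Set ((Fin n → ℝ) × ℝ)} {o z w : (Fin n → ℝ) × ℝ} {i : ℕ}
    (h : σ.index o i z = σ.index o i w) : σ.IsFree E o i z ↔ σ.IsFree E o i w := by
  simp only [IsFree, h]

/-- Two origins which define the same grid of level `j`. -/
def Aligned (o o' : (Fin n → ℝ) × ℝ) (j : ℕ) : Prop :=
  ∃ v : (Fin n → ℤ) × ℤ, o' = σ.node o j v

theorem Aligned.trans {o o' o'' : (Fin n → ℝ) × ℝ} {j : ℕ} (h : σ.Aligned o o' j)
    (h' : σ.Aligned o' o'' j) : σ.Aligned o o'' j := by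
  obtain ⟨v, rfl⟩ := h
  obtain ⟨w, rfl⟩ := h'
  refine ⟨v + w, ?_⟩
  ext <;> simp [node] <;> ring

theorem aligned_node {i j : ℕ} (hij : i ≤ j) (o : (Fin n → ℝ) × ℝ) (v : (Fin n → ℤ) × ℤ) :
    σ.Aligned o (σ.node o i v) j := by
  obtain ⟨N, -, hN⟩ := σ.l_of_le hij
  obtain ⟨M, -, hM⟩ := σ.τ_of_le hij
  refine ⟨(fun c => v.1 c * N, v.2 * M), ?_⟩
  ext <;> simp [node, hN, hM] <;> ring

theorem aligned_later {i j : ℕ} (hij : i ≤ j) (o : (Fin n → ℝ) × ℝ) (s : ℤ) :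
    σ.Aligned o (later o (s * σ.τ i)) j := by
  have : later o (s * σ.τ i) = σ.node o i (0, s) := by ext <;> simp [later, node]
  rw [this]
  exact σ.aligned_node hij o _

theorem Aligned.index_eq {o o' z w : (Fin n → ℝ) × ℝ} {j : ℕ} (h : σ.Aligned o o' j) :
    σ.index o' j z = σ.index o' j w ↔ σ.index o j z = σ.index o j w := by
  obtain ⟨v, rfl⟩ := h
  have aux : ∀ (x y s : ℝ) (a : ℤ), 0 < s → ⌊(x - (y + a * s)) / s⌋ = ⌊(x - y) / s⌋ - a := by
    intro x y s a hs
    rw [← Int.floor_sub_intCast]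
    congr 1
    field_simp
    ring
  simp only [index, node, aux _ _ _ _ (σ.l_pos j), aux _ _ _ _ (σ.τ_pos j), Prod.ext_iff,
    funext_iff, sub_left_inj]

theorem Aligned.isFree_iff {E : Set ((Fin n → ℝ) × ℝ)} {o o' z : (Fin n → ℝ) × ℝ} {j : ℕ}
    (h : σ.Aligned o o' j) : σ.IsFree E o' j z ↔ σ.IsFree E o j z := by
  simp only [IsFree, ne_eq, h.index_eq]

/-- Weak porosity in terms of a grid: if the translate in time of a box contains a free cell of
level `j`, then the free cells of level `j + m` fill a portion `c` of the box. -/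
def Porous (E : Set ((Fin n → ℝ) × ℝ)) (c : ℝ) (m : ℕ) (Φ : ℤ) : Prop :=
  ∀ (o : (Fin n → ℝ) × ℝ) (i j : ℕ), i ≤ j →
    (∃ z ∈ σ.box (later o (Φ * σ.τ i)) i, σ.IsFree E o j z) →
    c * volume.real (σ.box o i) ≤ volume.real (σ.box o i ∩ {z | σ.IsFree E o (j + m) z})

end Scales

end Parabolic

/-! ### Backward flow of holes. -/

namespace Parabolic

open MeasureTheory Set

namespace Scales

variable {p : ℝ} {d K n : ℕ} {σ : Scales p d K}
  {E : Set ((Fin n → ℝ) × ℝ)} {c : ℝ} {m : ℕ} {Φ : ℤ}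

/-- A box and a slight spatial shift of it overlap in more than the portion which weak porosity
leaves uncontrolled. -/
theorem Porous.shift (h : σ.Porous E c m Φ) {s e J : ℕ}
    (hs : 1 - c < (1 - 1 / ((2 ^ (d * s) : ℕ) : ℝ)) ^ n) (hJ : e + s ≤ J)
    (o : (Fin n → ℝ) × ℝ) (v : Fin n → ℤ) (hv : ∀ a, |v a| ≤ 1)
    (hz : ∃ z ∈ σ.box (later (σ.node o (e + s) (v, 0)) (Φ * σ.τ e)) e, σ.IsFree E o J z) :
    ∃ z ∈ σ.box o e, σ.IsFree E o (J + m) z := by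
  set o' := σ.node o (e + s) (v, 0) with ho'
  have hal : ∀ j, e + s ≤ j → σ.Aligned o o' j := fun j hj => σ.aligned_node hj o _
  obtain ⟨z, hz, hfree⟩ := hz
  have hvol := h o' e J (by omega) ⟨z, hz, (hal J hJ).isFree_iff.2 hfree⟩
  by_contra! hcon
  have hl := σ.l_add e s
  have hle := σ.l_pos (e + s)
  have hN : (1 : ℝ) ≤ ((2 ^ (d * s) : ℕ) : ℝ) := by exact_mod_cast Nat.one_le_two_pow
  set N : ℝ := ((2 ^ (d * s) : ℕ) : ℝ)
  have hv' : ∀ a, |o'.1 a - o.1 a| ≤ σ.l (e + s) := by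
    intro a
    have : (|(v a : ℝ)|) ≤ 1 := by exact_mod_cast hv a
    simp only [ho', node, add_sub_cancel_left, abs_mul, abs_of_pos hle]
    nlinarith
  set A : Set ((Fin n → ℝ) × ℝ) := prism (fun a => max (o.1 a) (o'.1 a), o.2)
    (fun a => min (o.1 a) (o'.1 a) + σ.l e, o.2 + σ.τ e) with hA
  have ho2 : o'.2 = o.2 := by simp [ho', node]
  have hlen : ∀ a, (1 - 1 / N) * σ.l e ≤
      min (o.1 a) (o'.1 a) + σ.l e - max (o.1 a) (o'.1 a) := by
    intro a
    have h1 : (1 - 1 / N) * σ.l e = σ.l e - σ.l (e + s) := by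
      rw [hl]; field_simp
    have := max_sub_min_eq_abs (o.1 a) (o'.1 a)
    rw [h1]
    linarith [hv' a]
  have hN1 : 0 ≤ 1 - 1 / N := by
    rw [sub_nonneg, div_le_one (by linarith)]; exact hN
  have hpos : 0 ≤ (1 - 1 / N) * σ.l e := mul_nonneg hN1 (σ.l_pos e).le
  have hAvol : (1 - 1 / N) ^ n * volume.real (σ.box o' e) ≤ volume.real A := by
    rw [hA, volume_real_prism, volume_real_box]
    · simp only [add_sub_cancel_left]
      rw [← mul_assoc, ← mul_pow]
      refine mul_le_mul_of_nonneg_right ?_ (σ.τ_pos e).le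
      calc ((1 - 1 / N) * σ.l e) ^ n = ∏ _a : Fin n, ((1 - 1 / N) * σ.l e) := by simp
        _ ≤ _ := Finset.prod_le_prod (fun _ _ => hpos) fun a _ => hlen a
    · refine ⟨fun a => ?_, by simpa using (σ.τ_pos e).le⟩
      have := hlen a
      simp only
      linarith
  have hAo : A ⊆ σ.box o e := by
    intro x hx
    rw [hA, mem_prism] at hx
    rw [mem_box]
    refine ⟨fun a => ⟨(le_max_left _ _).trans (hx.1 a).1, (hx.1 a).2.trans_le ?_⟩, hx.2⟩
    simp
  have hAo' : A ⊆ σ.box o' e := by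
    intro x hx
    rw [hA, mem_prism] at hx
    rw [mem_box, ho2]
    refine ⟨fun a => ⟨(le_max_right _ _).trans (hx.1 a).1, (hx.1 a).2.trans_le ?_⟩, hx.2⟩
    simp
  set F : Set ((Fin n → ℝ) × ℝ) := σ.box o' e ∩ {z | σ.IsFree E o' (J + m) z} with hF
  have hdisj : Disjoint A F := by
    rw [Set.disjoint_left]
    intro x hxA hxF
    exact hcon x (hAo hxA) ((hal _ (by omega)).isFree_iff.1 hxF.2)
  -- Without a free point in the box at `o`, the overlap `A` and the free part `F` would be disjoint
  -- in the shifted box, but their portions add up to more than 1.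
  have hsum : volume.real A + volume.real F ≤ volume.real (σ.box o' e) := by
    rw [← measureReal_union hdisj
      ((σ.measurableSet_box _ _).inter (σ.measurableSet_isFree _ _ _))
      (volume_prism_ne_top _ _)
      (measure_ne_top_of_subset inter_subset_left (σ.volume_box_ne_top _ _))]
    exact measureReal_mono (union_subset hAo' inter_subset_left) (σ.volume_box_ne_top _ _)
  have := σ.volume_real_box_pos o' e
  nlinarith

/-- Each use of `Porous.shift` goes back Φ time lengths, moves all coordinates at once by at most
one unit `l (e + s)`, and costs `m` levels. Thus the largest coordinate of `v` alone dictates how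
many steps are needed. -/
theorem Porous.chain (h : σ.Porous E c m Φ) {s e : ℕ}
    (hs : 1 - c < (1 - 1 / ((2 ^ (d * s) : ℕ) : ℝ)) ^ n) (r : ℕ) :
    ∀ (J : ℕ), e + s ≤ J → ∀ (o : (Fin n → ℝ) × ℝ) (v : Fin n → ℤ), (∀ a, |v a| ≤ r) →
    (∃ z ∈ σ.box (later (σ.node o (e + s) (v, 0)) ((r * Φ : ℤ) * σ.τ e)) e, σ.IsFree E o J z) →
    ∃ z ∈ σ.box o e, σ.IsFree E o (J + m * r) z := by
  induction r with
  | zero =>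
    intro J hJ o v hv hz
    have hv0 : v = 0 := by
      ext a
      simpa using hv a
    have : later (σ.node o (e + s) (v, 0)) (((0 : ℕ) * Φ : ℤ) * σ.τ e) = o := by
      ext <;> simp [later, node, hv0]
    rw [this] at hz
    simpa using hz
  | succ r ih =>
    intro J hJ o v hv hz
    set u : Fin n → ℤ := fun a => (v a).sign with hu
    have hu1 : ∀ a, |u a| ≤ 1 := by
      intro a
      rcases lt_trichotomy (v a) 0 with h0 | h0 | h0
      · simp [hu, Int.sign_eq_neg_one_of_neg h0]
      · simp [hu, h0]
      · simp [hu, Int.sign_eq_one_of_pos h0]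
    have hvu : ∀ a, |(v - u) a| ≤ r := by
      intro a
      have := hv a
      push_cast at this
      rw [abs_le] at this
      rw [Pi.sub_apply, abs_le]
      rcases lt_trichotomy (v a) 0 with h0 | h0 | h0
      · simp only [hu, Int.sign_eq_neg_one_of_neg h0]; omega
      · simp [hu, h0]
      · simp only [hu, Int.sign_eq_one_of_pos h0]; omega
    set o₁ := later (σ.node o (e + s) (u, 0)) (Φ * σ.τ e) with ho₁
    have hal : ∀ j, e + s ≤ j → σ.Aligned o o₁ j := fun j hj =>
      (σ.aligned_node hj o _).trans _ (σ.aligned_later (by omega) _ _)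
    have heq : later (σ.node o₁ (e + s) (v - u, 0)) ((r * Φ : ℤ) * σ.τ e) =
        later (σ.node o (e + s) (v, 0)) (((r + 1 : ℕ) * Φ : ℤ) * σ.τ e) := by
      ext <;> simp [later, node, ho₁] <;> ring
    obtain ⟨z, hz, hfree⟩ := hz
    obtain ⟨z', hz', hfree'⟩ := ih J hJ o₁ (v - u) hvu
      ⟨z, heq ▸ hz, (hal J hJ).isFree_iff.2 hfree⟩
    rw [Nat.mul_succ, ← add_assoc]
    exact h.shift hs (J := J + m * r) (by omega) o u hu1
      ⟨z', hz', (hal _ (by omega)).isFree_iff.1 hfree'⟩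

/-- Each `τ` lies between half of `l ^ p` and `l ^ p`, because truncation removes at most half of
the time interval; hence rounding errors in the numbers of parts do not accumulate over levels. -/
theorem half_rpow_le_ratio (σ : Scales p d K) {i q N : ℕ} (hN : σ.τ i = N * σ.τ (i + q)) :
    ((2 : ℝ) ^ (d * p)) ^ q / 2 ≤ N := by
  have h1 := σ.le_τ i
  have h2 := σ.τ_le (i + q)
  have hl := σ.l_pos (i + q)
  have hpow : 0 < σ.l (i + q) ^ p := Real.rpow_pos_of_pos hl p
  have h3 : σ.l i ^ p = ((2 : ℝ) ^ (d * p)) ^ q * σ.l (i + q) ^ p := by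
    rw [σ.l_add i q, Real.mul_rpow (by positivity) hl.le]
    congr 1
    push_cast
    rw [← Real.rpow_natCast, ← Real.rpow_natCast, ← Real.rpow_mul (by norm_num),
      ← Real.rpow_mul (by norm_num)]
    congr 1
    push_cast
    ring
  rw [hN, h3] at h1
  have : ((2 : ℝ) ^ (d * p)) ^ q / 2 * σ.l (i + q) ^ p ≤ N * σ.l (i + q) ^ p := by
    have := mul_le_mul_of_nonneg_left h2 (Nat.cast_nonneg (α := ℝ) N)
    linarith
  exact le_of_mul_le_mul_right this hpow

theorem exists_overlap_scale (n : ℕ) (hd : 1 ≤ d) (hc : 0 < c) :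
    ∃ s : ℕ, 1 - c < (1 - 1 / ((2 ^ (d * s) : ℕ) : ℝ)) ^ n := by
  have h1 : Filter.Tendsto (fun s : ℕ => (1 - 1 / ((2 ^ (d * s) : ℕ) : ℝ)) ^ n) Filter.atTop
      (nhds ((1 - 0) ^ n)) := by
    refine (Filter.Tendsto.const_sub 1 ?_).pow n
    have : (fun s : ℕ => 1 / ((2 ^ (d * s) : ℕ) : ℝ)) = fun s : ℕ => ((1 / 2 : ℝ) ^ d) ^ s := by
      ext s
      push_cast
      rw [← pow_mul, one_div, one_div, inv_pow]
    rw [this]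
    exact tendsto_pow_atTop_nhds_zero_of_lt_one (by positivity)
      (pow_lt_one₀ (by norm_num) (by norm_num) (by omega))
  rw [sub_zero, one_pow] at h1
  exact (h1.eventually (lt_mem_nhds (by linarith : 1 - c < 1))).exists

/-- Holes flow backwards in time: a free cell in the future of a box of level `i + 1` forces
the box to contain a free cell of comparable size. -/
def Flows (σ : Scales p d K) (E : Set ((Fin n → ℝ) × ℝ)) (M : ℕ) (Φ : ℤ) : Prop :=
  ∀ (o o' : (Fin n → ℝ) × ℝ) (i j : ℕ) (w : (Fin n → ℝ) × ℝ), i ≤ j →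
    σ.Aligned o o' (i + 1) → σ.IsFree E o j w →
    (∀ a, |w.1 a - o'.1 a| ≤ σ.l i) → o'.2 + 2 * σ.τ (i + 1) ≤ w.2 →
    w.2 ≤ o'.2 + (Φ + 1) * σ.τ i →
    ∃ z ∈ σ.box o' (i + 1), σ.IsFree E o (j + M) z

/-- As `p > 1`, the number of small boxes that fit in the time gap exceeds the number needed to
cross the spatial distance. -/
theorem exists_flow (n m K : ℕ) (hp : 1 < p) (hd : 1 ≤ d) (hc : 0 < c) (hΦ : 2 ≤ Φ) :
    ∃ M : ℕ, 2 ≤ M ∧ ∀ (σ : Scales p d K) (E : Set ((Fin n → ℝ) × ℝ)),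
      σ.Porous E c m Φ → σ.Flows E M Φ := by
  obtain ⟨s, hs⟩ := exists_overlap_scale (c := c) n hd hc
  have hΦ' : (2 : ℝ) ≤ Φ := by exact_mod_cast hΦ
  -- The bracket converts the distance `l i` into units `l (e + s)`, up to the factor 2 ^ (d q); the
  -- leading Φ is the time cost of one step.
  obtain ⟨q, hq⟩ : ∃ q : ℕ, (Φ : ℝ) * (2 ^ d * 2 ^ (d * s)) ≤ ((2 : ℝ) ^ (d * (p - 1))) ^ q := by
    obtain ⟨q, hq⟩ := pow_unbounded_of_one_lt ((Φ : ℝ) * (2 ^ d * 2 ^ (d * s)))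
      (Real.one_lt_rpow (x := 2) (z := d * (p - 1)) (by norm_num)
        (mul_pos (by exact_mod_cast hd) (by linarith)))
    exact ⟨q, hq.le⟩
  have hq' : (Φ : ℝ) * (2 ^ (d * (q + 1)) * 2 ^ (d * s)) ≤ ((2 : ℝ) ^ (d * p)) ^ q := by
    have e1 : ((2 : ℝ) ^ (d * p)) ^ q = ((2 : ℝ) ^ (d * (p - 1))) ^ q * 2 ^ (d * q) := by
      rw [pow_mul, ← mul_pow, ← Real.rpow_natCast 2 d, ← Real.rpow_add (by norm_num)]
      congr 2
      ring
    rw [e1, mul_add, pow_add, mul_one]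
    calc (Φ : ℝ) * (2 ^ (d * q) * 2 ^ d * 2 ^ (d * s))
        = (Φ : ℝ) * (2 ^ d * 2 ^ (d * s)) * 2 ^ (d * q) := by ring
      _ ≤ _ := mul_le_mul_of_nonneg_right hq (by positivity)
  -- The middle term is the descent to level `e + s`, the last one the cost of the longest chain;
  -- the extra 1 only secures `2 ≤ M`.
  refine ⟨1 + (q + 1 + s) + m * ((Φ + 1).toNat * K ^ (q + 1)), by omega, ?_⟩
  intro σ E hpor o o' i j w hij hal hw hsp hlow hup
  obtain ⟨N, hN9, -, hN⟩ := σ.τ_add (i + 1) q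
  obtain ⟨N', -, hN'K, hN'⟩ := σ.τ_add i (q + 1)
  have hNlow := σ.half_rpow_le_ratio hN
  set e := i + 1 + q with he
  have he' : i + (q + 1) = e := by omega
  rw [he'] at hN'
  have hτ := σ.τ_pos e
  have hle := σ.l_pos e
  have hNΦ : (Φ : ℝ) * (2 ^ (d * (q + 1)) * 2 ^ (d * s)) ≤ 2 * N := by linarith
  -- The factor 1/2 lost in `half_rpow_le_ratio` is repaid by the time gap, which is twice `τ (i +
  -- 1)`.
  have hNΦ' : Φ * (2 ^ (d * (q + 1)) * 2 ^ (d * s)) ≤ 2 * (N : ℤ) := by exact_mod_cast hNΦ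
  have hΦN : Φ ≤ (N : ℤ) := by
    have h2 : (2 : ℤ) ≤ 2 ^ (d * (q + 1)) :=
      le_self_pow₀ (by norm_num) (Nat.mul_ne_zero (by omega) (by omega))
    have h1 : (1 : ℤ) ≤ 2 ^ (d * s) := one_le_pow₀ (by norm_num)
    have : (2 : ℤ) ≤ 2 ^ (d * (q + 1)) * 2 ^ (d * s) := by nlinarith
    nlinarith
  set α := (σ.index o' e w).1 with hα
  set β := (σ.index o' e w).2 with hβ
  have hβ1 : 2 * (N : ℤ) ≤ β := by
    simp only [hβ, index]
    rw [Int.le_floor, le_div_iff₀ hτ]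
    push_cast
    rw [hN] at hlow
    linarith
  have hβ2 : β ≤ (Φ + 1) * N' := by
    have : (β : ℝ) ≤ (Φ + 1) * N' := by
      refine (Int.floor_le _).trans ?_
      rw [div_le_iff₀ hτ]
      rw [hN'] at hup
      linarith
    exact_mod_cast this
  have hli : σ.l i = 2 ^ (d * (q + 1)) * σ.l e := by
    have := σ.l_add i (q + 1)
    rw [he'] at this
    rw [this]
    push_cast
    rfl
  have hα1 : ∀ a, |α a| ≤ 2 ^ (d * (q + 1)) := by
    intro a
    have ha := hsp a
    rw [hli, abs_le] at ha
    rw [abs_le]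
    simp only [hα, index]
    constructor
    · rw [Int.le_floor, le_div_iff₀ hle]
      push_cast
      linarith [ha.1]
    · have : ((⌊(w.1 a - o'.1 a) / σ.l e⌋ : ℤ) : ℝ) ≤ 2 ^ (d * (q + 1)) := by
        refine (Int.floor_le _).trans ?_
        rw [div_le_iff₀ hle]
        exact ha.2
      exact_mod_cast this
  -- A chain covers multiples of Φ only. The remainder is absorbed by delaying the target box by `b`
  -- units, and since `b < Φ ≤ N` it stays inside the box of level `i + 1`.
  set b := β % Φ with hb
  have hb0 : 0 ≤ b := Int.emod_nonneg _ (by omega)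
  have hbΦ : b < Φ := Int.emod_lt_of_pos _ (by omega)
  have hdiv : b + Φ * (β / Φ) = β := Int.emod_add_mul_ediv β Φ
  have hr0 : 2 ^ (d * (q + 1)) * 2 ^ (d * s) ≤ β / Φ := by
    rw [Int.le_ediv_iff_mul_le (by omega)]
    linarith
  have hrpos : 0 ≤ β / Φ := le_trans (by positivity) hr0
  obtain ⟨r, hr⟩ := Int.eq_ofNat_of_zero_le hrpos
  rw [hr] at hdiv hr0
  have hrle : r ≤ (Φ + 1).toNat * K ^ (q + 1) := by
    have h1 : (r : ℤ) ≤ (Φ + 1) * N' := by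
      rw [← hr]
      exact (Int.ediv_le_self _ (by omega)).trans hβ2
    have h2 : ((Φ + 1).toNat : ℤ) = Φ + 1 := Int.toNat_of_nonneg (by omega)
    have h3 : r ≤ (Φ + 1).toNat * N' := by
      zify
      rwa [h2]
    exact h3.trans (Nat.mul_le_mul_left _ hN'K)
  set oB := later o' (b * σ.τ e) with hoB
  set J := max j (e + s) with hJ
  have halB : ∀ J, e ≤ J → σ.Aligned o oB J := by
    intro J hJ
    obtain ⟨v, hv⟩ := hal
    rw [hoB, hv]
    exact (σ.aligned_node (by omega) o _).trans _ (σ.aligned_later hJ _ _)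
  have hwJ : σ.IsFree E oB J w := (halB J (by omega)).isFree_iff.2 (hw.mono _ (le_max_left _ _))
  have hcell := σ.mem_cell_self o' w e
  have hcorner : later (σ.node oB (e + s) (fun a => α a * 2 ^ (d * s), 0))
      ((r * Φ : ℤ) * σ.τ e) = σ.node o' e (σ.index o' e w) := by
    have h1 := σ.l_add e s
    have h2 : (β : ℝ) = b + Φ * r := by exact_mod_cast hdiv.symm
    ext a
    · simp only [later, node, hoB, h1, ← hα]
      push_cast
      ring
    · simp only [later, node, hoB, ← hβ, h2]
      push_cast
      ring
  obtain ⟨z, hz, hzf⟩ := hpor.chain hs r J (le_max_right _ _) oB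
    (fun a => α a * 2 ^ (d * s))
    (fun a => by
      rw [abs_mul, abs_of_pos (by positivity : (0 : ℤ) < 2 ^ (d * s))]
      exact (mul_le_mul_of_nonneg_right (hα1 a) (by positivity)).trans hr0)
    ⟨w, hcorner ▸ hcell, hwJ⟩
  refine ⟨z, ?_, ?_⟩
  · rw [mem_box] at hz ⊢
    have hlm := σ.l_anti (show i + 1 ≤ e by omega)
    have hb1 : (b : ℝ) + 1 ≤ N := by exact_mod_cast (by omega : b + 1 ≤ (N : ℤ))
    have hb0' : (0 : ℝ) ≤ b := by exact_mod_cast hb0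
    simp only [hoB, later] at hz
    refine ⟨fun a => ⟨(hz.1 a).1, (hz.1 a).2.trans_le (by linarith)⟩, ?_, ?_⟩
    · nlinarith [hz.2.1]
    · rw [hN]
      nlinarith [hz.2.2]
  · refine ((halB _ (by omega)).isFree_iff.1 hzf).mono _ ?_
    have := Nat.mul_le_mul_left m hrle
    omega

end Scales

end Parabolic

/-! ### Covering a fixed portion of the remaining set in each generation. -/

namespace Parabolic

open MeasureTheory Set

namespace Scales

variable {p : ℝ} {d K n : ℕ} {σ : Scales p d K}
  {E : Set ((Fin n → ℝ) × ℝ)} {c : ℝ} {m M : ℕ} {Φ : ℤ}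

/-- The level `i` cell of `z`. -/
noncomputable def cell (σ : Scales p d K) (o : (Fin n → ℝ) × ℝ) (i : ℕ) (z : (Fin n → ℝ) × ℝ) :
    Set ((Fin n → ℝ) × ℝ) :=
  σ.box (σ.node o i (σ.index o i z)) i

/-- The level `i` cell of `z`, translated in time by `t` times its side length, contains a free
cell of level `j`. -/
def HoleAfter (σ : Scales p d K) (E : Set ((Fin n → ℝ) × ℝ)) (o : (Fin n → ℝ) × ℝ) (i j : ℕ)
    (t : ℤ) (z : (Fin n → ℝ) × ℝ) : Prop :=
  ∃ w ∈ σ.cell o i (later z (t * σ.τ i)), σ.IsFree E o j w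

theorem mem_cell_iff {o z w : (Fin n → ℝ) × ℝ} {i : ℕ} :
    w ∈ σ.cell o i z ↔ σ.index o i w = σ.index o i z := σ.mem_cell

theorem index_later (o z : (Fin n → ℝ) × ℝ) (i : ℕ) (t : ℤ) :
    σ.index o i (later z (t * σ.τ i)) = ((σ.index o i z).1, (σ.index o i z).2 + t) := by
  have := σ.τ_pos i
  simp only [index, later, Prod.mk.injEq, true_and]
  rw [← Int.floor_add_intCast]
  congr 1
  field_simp
  ring

theorem node_index_later (o z : (Fin n → ℝ) × ℝ) (i : ℕ) (t : ℤ) :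
    σ.node o i (σ.index o i (later z (t * σ.τ i))) =
      later (σ.node o i (σ.index o i z)) (t * σ.τ i) := by
  rw [index_later]
  ext
  · rfl
  · simp only [node, later]; push_cast; ring

theorem node_mem_cell (o z : (Fin n → ℝ) × ℝ) (i : ℕ) :
    σ.node o i (σ.index o i z) ∈ σ.cell o i z := by
  rw [cell, mem_box]
  have h1 := σ.l_pos i
  have h2 := σ.τ_pos i
  exact ⟨fun a => ⟨le_rfl, by linarith⟩, le_rfl, by linarith⟩

theorem cell_subset {o z w : (Fin n → ℝ) × ℝ} {i j : ℕ} (hij : i ≤ j) (h : w ∈ σ.cell o i z) :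
    σ.cell o j w ⊆ σ.cell o i z := by
  intro x hx
  rw [mem_cell_iff] at hx h ⊢
  exact (σ.index_coarsen hij hx).trans h

/-- A hole in the future of a cell forces comparable holes in the nearer future of its
subcells. -/
theorem Flows.holeAfter_succ (hF : σ.Flows E M Φ) (hΦ : 2 ≤ Φ) {o z : (Fin n → ℝ) × ℝ}
    {i j : ℕ} (hij : i ≤ j) {t : ℤ} (ht0 : 0 ≤ t) (ht : t ≤ 2 * Φ)
    (h : σ.HoleAfter E o i j Φ z) : σ.HoleAfter E o (i + 1) (j + M) t z := by
  obtain ⟨w, hw, hfree⟩ := h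
  rw [cell, node_index_later, mem_box] at hw
  have hq := σ.cell_subset (Nat.le_succ i) (σ.mem_cell_self o z i)
    (σ.node_mem_cell o z (i + 1))
  rw [cell, mem_box] at hq
  rw [HoleAfter, cell, node_index_later]
  have hΦ' : (2 : ℝ) ≤ Φ := by exact_mod_cast hΦ
  have ht0' : (0 : ℝ) ≤ t := by exact_mod_cast ht0
  have ht' : (t : ℝ) ≤ 2 * Φ := by exact_mod_cast ht
  have h9 := σ.nine_mul_τ_succ_le i
  have hτ := σ.τ_pos (i + 1)
  simp only [later] at hw
  refine hF o _ i j w hij ((σ.aligned_node le_rfl o _).trans _ (σ.aligned_later le_rfl _ _))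
    hfree (fun a => ?_) ?_ ?_
  · have h1 := hw.1 a
    have h2 := hq.1 a
    simp only [later]
    rw [abs_le]
    constructor <;> linarith
  · simp only [later]
    -- The gap is at least (Φ - 1) `τ i`, hence at least 9 (Φ - 1) `τ (i + 1)`, and 9 (Φ - 1) ≥ 2 Φ
    -- + 2 as Φ ≥ 2. The range up to 2 Φ lets porosity be applied to a cell already shifted by Φ.
    have h1 : (t : ℝ) * σ.τ (i + 1) ≤ 2 * Φ * σ.τ (i + 1) := mul_le_mul_of_nonneg_right ht' hτ.le
    have h2 : (Φ - 1 : ℝ) * (9 * σ.τ (i + 1)) ≤ (Φ - 1) * σ.τ i :=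
      mul_le_mul_of_nonneg_left h9 (by linarith)
    nlinarith [hw.2.1, hq.2.2]
  · simp only [later]
    nlinarith [hw.2.2, hq.2.1, mul_nonneg ht0' hτ.le]

/-- The part of space-time over the cube of the box at `o` in which holes are counted at
generation `g`. -/
noncomputable def slab (σ : Scales p d K) (o : (Fin n → ℝ) × ℝ) (Φ : ℤ) (g : ℕ) :
    Set ((Fin n → ℝ) × ℝ) :=
  prism o (fun a => o.1 a + σ.l 0, o.2 + (σ.τ 0 + Φ * σ.τ g))

theorem mem_slab {o z : (Fin n → ℝ) × ℝ} {g : ℕ} : z ∈ σ.slab o Φ g ↔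
    (∀ a, o.1 a ≤ z.1 a ∧ z.1 a < o.1 a + σ.l 0) ∧ o.2 ≤ z.2 ∧
      z.2 < o.2 + (σ.τ 0 + Φ * σ.τ g) :=
  mem_prism

theorem slab_anti (σ : Scales p d K) (hΦ : 2 ≤ Φ) (o : (Fin n → ℝ) × ℝ) :
    Antitone (σ.slab o Φ) := by
  intro g g' h z hz
  rw [mem_slab] at hz ⊢
  have hΦ' : (2 : ℝ) ≤ Φ := by exact_mod_cast hΦ
  refine ⟨hz.1, hz.2.1, hz.2.2.trans_le ?_⟩
  have := mul_le_mul_of_nonneg_left (σ.τ_anti h) (show (0 : ℝ) ≤ Φ by linarith)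
  linarith

/-- The first generation is separate because the slab protrudes beyond the box at `o`, so `z` need
not lie in it and `Flows.holeAfter_succ` does not apply. -/
theorem Flows.holeAfter_one (hF : σ.Flows E M Φ) (hΦ : 2 ≤ Φ) {o z : (Fin n → ℝ) × ℝ} {ℓ : ℕ}
    (h : ∃ w ∈ σ.box (later o (Φ * σ.τ 0)) 0, σ.IsFree E o ℓ w) (hz : z ∈ σ.slab o Φ 1) :
    σ.HoleAfter E o 1 (ℓ + M) Φ z := by
  obtain ⟨w, hw, hfree⟩ := h
  rw [mem_box] at hw
  rw [mem_slab] at hz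
  have hq := σ.mem_cell_self o z 1
  rw [mem_box] at hq
  rw [HoleAfter, cell, node_index_later]
  have hΦ' : (2 : ℝ) ≤ Φ := by exact_mod_cast hΦ
  have h9 := σ.nine_mul_τ_succ_le 0
  have hτ := σ.τ_pos 1
  have hl := σ.l_pos 1
  have hsp : ∀ a, o.1 a ≤ (σ.node o 1 (σ.index o 1 z)).1 a := by
    intro a
    have : (0 : ℝ) ≤ ((σ.index o 1 z).1 a : ℝ) := by
      exact_mod_cast Int.floor_nonneg.2 (div_nonneg (by linarith [(hz.1 a).1]) hl.le)
    simp only [node]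
    nlinarith
  have htm : o.2 ≤ (σ.node o 1 (σ.index o 1 z)).2 := by
    have : (0 : ℝ) ≤ ((σ.index o 1 z).2 : ℝ) := by
      exact_mod_cast Int.floor_nonneg.2 (div_nonneg (by linarith [hz.2.1]) hτ.le)
    simp only [node]
    nlinarith
  simp only [later] at hw
  simp only [zero_add] at h9
  refine hF o _ 0 ℓ w (Nat.zero_le _)
    ((σ.aligned_node le_rfl o _).trans _ (σ.aligned_later le_rfl _ _)) hfree (fun a => ?_) ?_ ?_
  · have h1 := hw.1 a
    have h2 := hq.1 a
    have h3 := hsp a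
    have h4 := hz.1 a
    simp only [later]
    rw [abs_le]
    constructor <;> linarith
  · simp only [later, zero_add]
    have h2 : (Φ - 1 : ℝ) * (9 * σ.τ 1) ≤ (Φ - 1) * σ.τ 0 :=
      mul_le_mul_of_nonneg_left h9 (by linarith)
    nlinarith [hw.2.1, hq.2.1, hz.2.2]
  · simp only [later]
    nlinarith [hw.2.2]

theorem Flows.holeAfter (hF : σ.Flows E M Φ) (hM : 1 ≤ M) (hΦ : 2 ≤ Φ)
    {o z : (Fin n → ℝ) × ℝ} {ℓ : ℕ}
    (h : ∃ w ∈ σ.box (later o (Φ * σ.τ 0)) 0, σ.IsFree E o ℓ w) (hz : z ∈ σ.slab o Φ 1)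
    (g : ℕ) : σ.HoleAfter E o (g + 1) (ℓ + M * (g + 1)) Φ z := by
  induction g with
  | zero => simpa using hF.holeAfter_one hΦ h hz
  | succ g ih =>
    have := hF.holeAfter_succ hΦ (by nlinarith) (t := Φ) (by omega) (by omega) ih
    rwa [add_assoc ℓ, ← Nat.mul_succ] at this

/-- Near every point outside the holes of level `ℓ` there is a cell outside these holes, a fixed
portion of which is covered by slightly smaller holes. -/
theorem Porous.exists_cell (hP : σ.Porous E c m Φ) (hF : σ.Flows E M Φ) (hΦ : 2 ≤ Φ)
    {o z : (Fin n → ℝ) × ℝ} {g ℓ : ℕ} (hg : g + 1 ≤ ℓ) (hz : ¬σ.IsFree E o ℓ z)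
    (h : σ.HoleAfter E o g ℓ Φ z) :
    ∃ i, g + 1 ≤ i ∧ i ≤ ℓ ∧ ∃ t : ℤ, (0 ≤ t ∧ t ≤ Φ) ∧
      (∀ x ∈ σ.cell o i (later z (t * σ.τ i)), ¬σ.IsFree E o ℓ x) ∧
      c * volume.real (σ.cell o i (later z (t * σ.τ i))) ≤
        volume.real (σ.cell o i (later z (t * σ.τ i)) ∩ {x | σ.IsFree E o (ℓ + (M + m)) x}) := by
  have key : ∀ (i j : ℕ) (t : ℤ), i ≤ j → σ.HoleAfter E o i j (t + Φ) z →
      c * volume.real (σ.cell o i (later z (t * σ.τ i))) ≤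
        volume.real (σ.cell o i (later z (t * σ.τ i)) ∩ {x | σ.IsFree E o (j + m) x}) := by
    intro i j t hij ⟨w, hw, hfree⟩
    rw [cell, node_index_later] at hw ⊢
    set o' := later (σ.node o i (σ.index o i z)) (t * σ.τ i) with ho'
    have hal : ∀ j, i ≤ j → σ.Aligned o o' j := fun j hj =>
      (σ.aligned_node hj o _).trans _ (σ.aligned_later hj _ _)
    have heq : later (σ.node o i (σ.index o i z)) ((t + Φ : ℤ) * σ.τ i) =
        later o' (Φ * σ.τ i) := by
      ext
      · rfl
      · simp only [later, ho']; push_cast; ring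
    have := hP o' i j hij ⟨w, heq ▸ hw, (hal j hij).isFree_iff.2 hfree⟩
    simpa only [(hal (j + m) (by omega)).isFree_iff] using this
  have hsub : ∀ {A : Set ((Fin n → ℝ) × ℝ)} {i : ℕ} (x : (Fin n → ℝ) × ℝ) (j : ℕ),
      A = σ.cell o i x → j ≤ ℓ + (M + m) →
      volume.real (A ∩ {x | σ.IsFree E o j x}) ≤
        volume.real (A ∩ {x | σ.IsFree E o (ℓ + (M + m)) x}) := by
    intro A i x j hA hj
    refine measureReal_mono (inter_subset_inter_right _ fun y hy => hy.mono _ hj) ?_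
    exact measure_ne_top_of_subset inter_subset_left (hA ▸ σ.volume_box_ne_top _ _)
  by_cases htop : σ.HoleAfter E o ℓ ℓ Φ z
  -- If the hole ahead survives down to level `ℓ`, the unshifted level `ℓ` cell of `z` serves.
  · refine ⟨ℓ, hg, le_rfl, 0, ⟨le_rfl, by omega⟩, fun x hx => ?_, ?_⟩
    · rw [mem_cell_iff] at hx
      rw [σ.isFree_congr hx]
      simpa [later] using hz
    · exact (key ℓ ℓ 0 le_rfl (by simpa using htop)).trans (hsub _ _ rfl (by omega))
  -- Otherwise stop at the first level where the cell shifted by Φ contains no old hole. Its parent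
  -- level still has one, so the flow produces a hole at shift 2 Φ, which is the future that
  -- porosity of the cell at shift Φ requires.
  · have hex : ∃ i, ¬σ.HoleAfter E o (g + i) ℓ Φ z := ⟨ℓ - g, by
      rwa [Nat.add_sub_cancel' (by omega)]⟩
    classical
    have hfind := Nat.find_spec hex
    have hmin := fun k (hk : k < Nat.find hex) => Nat.find_min hex hk
    have hle : Nat.find hex ≤ ℓ - g := Nat.find_min' hex (by
      rwa [Nat.add_sub_cancel' (by omega)])
    obtain ⟨i, hi⟩ : ∃ i, Nat.find hex = i + 1 := by
      refine Nat.exists_eq_succ_of_ne_zero fun h0 => ?_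
      rw [h0] at hfind
      exact hfind h
    rw [hi] at hfind hle
    have hprev : σ.HoleAfter E o (g + i) ℓ Φ z := by
      have := hmin i (by omega)
      rwa [not_not] at this
    refine ⟨g + i + 1, by omega, by omega, Φ, ⟨by omega, le_rfl⟩, fun x hx hfree => ?_, ?_⟩
    · exact hfind ⟨x, hx, hfree⟩
    · have h2 := hF.holeAfter_succ hΦ (by omega) (t := Φ + Φ) (by omega) (by omega) hprev
      exact (key _ _ Φ (by omega) h2).trans (hsub _ _ rfl (by omega))

theorem volume_prism_extended (hΦ : 2 ≤ Φ) (o : (Fin n → ℝ) × ℝ) (i : ℕ) :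
    volume (prism (o.1, o.2 - Φ * σ.τ i) (fun a => o.1 a + σ.l i, o.2 + σ.τ i)) =
      ENNReal.ofReal (Φ + 1) * volume (σ.box o i) := by
  have hΦ' : (2 : ℝ) ≤ Φ := by exact_mod_cast hΦ
  have hl := σ.l_pos i
  have hτ := σ.τ_pos i
  rw [box, volume_prism, volume_prism, ← ENNReal.ofReal_mul (by linarith)]
  · congr 1
    simp only
    ring
  · exact ⟨fun a => by simpa using hl.le, by simpa using hτ.le⟩
  · refine ⟨fun a => by simpa using hl.le, ?_⟩
    simp only
    nlinarith

/-- The cells of `exists_cell` stay in the slab of the previous generation. -/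
theorem cell_later_subset_slab (hΦ : 2 ≤ Φ) {o z : (Fin n → ℝ) × ℝ} {g i : ℕ} {t : ℤ}
    (hi : g + 1 ≤ i) (ht0 : 0 ≤ t) (ht : t ≤ Φ) (hz : z ∈ σ.slab o Φ (g + 1)) :
    σ.cell o i (later z (t * σ.τ i)) ⊆ σ.slab o Φ g := by
  intro x hx
  have hΦ' : (2 : ℝ) ≤ Φ := by exact_mod_cast hΦ
  have ht0' : (0 : ℝ) ≤ t := by exact_mod_cast ht0
  have ht' : (t : ℝ) ≤ Φ := by exact_mod_cast ht
  rw [mem_slab] at hz ⊢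
  have hidx := mem_cell_iff.1 hx
  have hτ := σ.τ_pos i
  refine ⟨fun a => ?_, ?_, ?_⟩
  · have h0 := congrFun (congrArg Prod.fst (σ.index_coarsen (Nat.zero_le i) hidx)) a
    have hz0 : ⌊(z.1 a - o.1 a) / σ.l 0⌋ = 0 := by
      rw [Int.floor_eq_zero_iff, mem_Ico, le_div_iff₀ (σ.l_pos 0), div_lt_iff₀ (σ.l_pos 0)]
      have := hz.1 a
      constructor <;> linarith
    simp only [index, later] at h0
    rw [hz0, Int.floor_eq_zero_iff, mem_Ico, le_div_iff₀ (σ.l_pos 0),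
      div_lt_iff₀ (σ.l_pos 0)] at h0
    constructor <;> linarith
  · have h0 := congrArg Prod.snd hidx
    rw [index_later] at h0
    have h1 : (0 : ℤ) ≤ (σ.index o i z).2 :=
      Int.floor_nonneg.2 (div_nonneg (by linarith [hz.2.1]) hτ.le)
    have h2 : (0 : ℤ) ≤ (σ.index o i x).2 := by rw [h0]; exact add_nonneg h1 ht0
    have h3 := (le_div_iff₀ hτ).1 (Int.floor_nonneg.1 h2)
    linarith
  · rw [cell, mem_box, node_index_later] at hx
    have h1 := σ.mem_cell_self o z i
    rw [mem_box] at h1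
    have h2 := hx.2.2
    simp only [later] at h2
    have h3 := σ.τ_anti hi
    have h4 := σ.nine_mul_τ_succ_le g
    -- The upper end grows by at most (2 Φ + 1) `τ (g + 1)` beyond `o.2 + τ 0`, which is below 9 Φ
    -- `τ (g + 1)` ≤ Φ `τ g`.
    have h5 : (t + 1) * σ.τ i ≤ (Φ + 1) * σ.τ (g + 1) :=
      mul_le_mul (by linarith) h3 hτ.le (by linarith)
    have h6 : (Φ : ℝ) * (9 * σ.τ (g + 1)) ≤ Φ * σ.τ g :=
      mul_le_mul_of_nonneg_left h4 (by linarith)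
    nlinarith [hz.2.2, h1.2.1, σ.τ_pos (g + 1)]

/-- In each generation a fixed portion of the remaining set is covered by new holes. -/
theorem Porous.generation (hP : σ.Porous E c m Φ) (hF : σ.Flows E M Φ) (hΦ : 2 ≤ Φ)
    {o : (Fin n → ℝ) × ℝ} {g ℓ : ℕ} (hg : g + 1 ≤ ℓ)
    (h : ∀ z ∈ σ.slab o Φ (g + 1), σ.HoleAfter E o g ℓ Φ z) :
    ENNReal.ofReal c * volume (σ.slab o Φ (g + 1) \ {z | σ.IsFree E o ℓ z}) ≤
      ENNReal.ofReal (Φ + 1) * volume ((σ.slab o Φ g \ {z | σ.IsFree E o ℓ z}) ∩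
        {z | σ.IsFree E o (ℓ + (M + m)) z}) := by
  set V : Set ((Fin n → ℝ) × ℝ) := (σ.slab o Φ g \ {z | σ.IsFree E o ℓ z}) with hV
  set F : Set ((Fin n → ℝ) × ℝ) := {z | σ.IsFree E o (ℓ + (M + m)) z} with hFdef
  have hFm : MeasurableSet F := σ.measurableSet_isFree _ _ _
  set C : ℕ × ((Fin n → ℤ) × ℤ) → Set ((Fin n → ℝ) × ℝ) := fun q => σ.box (σ.node o q.1 q.2) q.1
    with hC
  have hCm : ∀ q x, x ∈ C q ↔ σ.index o q.1 x = q.2 := fun q x => σ.mem_cell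
  have hnest : ∀ q q', q.1 ≤ q'.1 → ¬Disjoint (C q) (C q') → C q' ⊆ C q := by
    intro q q' hqq hd x hx
    obtain ⟨y, hy, hy'⟩ := Set.not_disjoint_iff.1 hd
    rw [hCm] at hx hy hy' ⊢
    rw [← hy]
    exact σ.index_coarsen hqq (hx.trans hy'.symm)
  set good : Set (ℕ × ((Fin n → ℤ) × ℤ)) :=
    {q | C q ⊆ V ∧ c * volume.real (C q) ≤ volume.real (C q ∩ F)} with hgood
  -- Good cells are nested or disjoint; the coarsest ones are disjoint, and every good cell lies in
  -- one of them.
  set top : Set (ℕ × ((Fin n → ℤ) × ℤ)) :=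
    {q | q ∈ good ∧ ∀ q' ∈ good, q'.1 < q.1 → Disjoint (C q') (C q)} with htop
  have htopdisj : top.PairwiseDisjoint C := by
    intro q hq q' hq' hne
    rcases lt_trichotomy q.1 q'.1 with hlt | heq | hlt
    · exact hq'.2 q hq.1 hlt
    · rw [Function.onFun, Set.disjoint_left]
      intro x hx hx'
      rw [hCm] at hx hx'
      exact hne (Prod.ext heq (by rw [← hx, ← hx', heq]))
    · exact (hq.2 q' hq'.1 hlt).symm
  have hcover : ∀ q ∈ good, ∃ q' ∈ top, q'.1 ≤ q.1 ∧ C q ⊆ C q' := by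
    intro q hq
    classical
    have hex : ∃ i, ∃ q' ∈ good, q'.1 = i ∧ C q ⊆ C q' := ⟨q.1, q, hq, rfl, Subset.rfl⟩
    obtain ⟨q', hq', hi, hsub⟩ := Nat.find_spec hex
    have hmin := fun k (hk : k < Nat.find hex) => Nat.find_min hex hk
    refine ⟨q', ⟨hq', fun q'' hq'' hlt => ?_⟩, ?_, hsub⟩
    · by_contra hnd
      exact hmin q''.1 (hi ▸ hlt) ⟨q'', hq'', rfl, hsub.trans (hnest q'' q' hlt.le hnd)⟩
    · rw [hi]
      exact Nat.find_min' hex ⟨q, hq, rfl, Subset.rfl⟩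
  -- A point precedes its good cell by at most Φ of that cell's time lengths, hence by at most Φ of
  -- the longer ones of the containing top cell. Prolonging by Φ lengths costs the factor Φ + 1 in
  -- measure.
  set ext : ℕ × ((Fin n → ℤ) × ℤ) → Set ((Fin n → ℝ) × ℝ) := fun q =>
    prism ((σ.node o q.1 q.2).1, (σ.node o q.1 q.2).2 - Φ * σ.τ q.1)
      (fun a => (σ.node o q.1 q.2).1 a + σ.l q.1, (σ.node o q.1 q.2).2 + σ.τ q.1) with hext
  have hΦ' : (2 : ℝ) ≤ Φ := by exact_mod_cast hΦ
  have hsubset : σ.slab o Φ (g + 1) \ {z | σ.IsFree E o ℓ z} ⊆ ⋃ q ∈ top, ext q := by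
    rintro z ⟨hz, hzf⟩
    obtain ⟨i, hi, -, t, ⟨ht0, ht⟩, hU, hvol⟩ := hP.exists_cell hF hΦ hg hzf (h z hz)
    set z' := later z (t * σ.τ i) with hz'
    have hq : (i, σ.index o i z') ∈ good :=
      ⟨fun x hx => ⟨cell_later_subset_slab hΦ hi ht0 ht hz hx, hU x hx⟩, hvol⟩
    obtain ⟨q, hqtop, hle, hsub⟩ := hcover _ hq
    have hmem : z' ∈ C q := hsub (σ.mem_cell_self o z' i)
    refine mem_biUnion hqtop ?_
    rw [hC, mem_box] at hmem
    simp only [hext, mem_prism]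
    simp only [hz', later] at hmem
    have ht0' : (0 : ℝ) ≤ t := by exact_mod_cast ht0
    have ht' : (t : ℝ) ≤ Φ := by exact_mod_cast ht
    have hτ : (t : ℝ) * σ.τ i ≤ Φ * σ.τ q.1 :=
      mul_le_mul ht' (σ.τ_anti hle) (σ.τ_pos i).le (by linarith)
    refine ⟨hmem.1, by linarith [hmem.2.1], ?_⟩
    have := mul_nonneg ht0' (σ.τ_pos i).le
    linarith [hmem.2.2]
  have hcount : top.Countable := Set.to_countable _
  have hone : ∀ q ∈ top, ENNReal.ofReal c * volume (C q) ≤ volume (C q ∩ F) := by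
    intro q hq
    have h1 : volume (C q) ≠ ⊤ := σ.volume_box_ne_top _ _
    have h2 : volume (C q ∩ F) ≠ ⊤ := measure_ne_top_of_subset inter_subset_left h1
    have h3 := ENNReal.ofReal_le_ofReal hq.1.2
    rwa [ENNReal.ofReal_mul' measureReal_nonneg, ofReal_measureReal h1,
      ofReal_measureReal h2] at h3
  calc ENNReal.ofReal c * volume (σ.slab o Φ (g + 1) \ {z | σ.IsFree E o ℓ z})
      ≤ ENNReal.ofReal c * ∑' q : top, volume (ext q) := by
        gcongr
        exact (measure_mono hsubset).trans (measure_biUnion_le _ hcount _)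
    _ = ENNReal.ofReal (Φ + 1) * ∑' q : top, ENNReal.ofReal c * volume (C q) := by
        simp only [hext, volume_prism_extended hΦ, ENNReal.tsum_mul_left]
        simp only [hC]
        ring
    _ ≤ ENNReal.ofReal (Φ + 1) * ∑' q : top, volume (C q ∩ F) := by
        gcongr with q
        exact hone q q.2
    _ = ENNReal.ofReal (Φ + 1) * volume (⋃ q ∈ top, C q ∩ F) := by
        rw [measure_biUnion hcount]
        · exact htopdisj.mono fun q => inter_subset_left
        · exact fun q _ => (σ.measurableSet_box _ _).inter hFm
    _ ≤ _ := by
        gcongr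
        exact iUnion₂_subset fun q hq => inter_subset_inter_left _ hq.1.1

/-- The newly covered set is at least c / (Φ + 1) times what remains afterwards, so every generation
divides the remainder by 1 + c / (Φ + 1). The slabs shrink with the generation to make room for the
forward shifts. -/
theorem Porous.decay (hP : σ.Porous E c m Φ) (hc : 0 < c) (hF : σ.Flows E M Φ) (hM : 2 ≤ M)
    (hΦ : 2 ≤ Φ) {o : (Fin n → ℝ) × ℝ} {ℓ : ℕ}
    (h : ∃ w ∈ σ.box (later o (Φ * σ.τ 0)) 0, σ.IsFree E o ℓ w) (N : ℕ) :
    volume.real (σ.slab o Φ (N + 1) \ {z | σ.IsFree E o (ℓ + (M + m) * (N + 1)) z}) ≤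
      (Φ + 1) * volume.real (σ.box o 0) * ((1 + c / (Φ + 1))⁻¹) ^ N := by
  have hΦ' : (2 : ℝ) ≤ Φ := by exact_mod_cast hΦ
  have hfin : ∀ g, volume (σ.slab o Φ g) ≠ ⊤ := fun g => volume_prism_ne_top _ _
  induction N with
  | zero =>
    have h1 : volume.real (σ.slab o Φ 1) = σ.l 0 ^ n * (σ.τ 0 + Φ * σ.τ 1) := by
      rw [slab, volume_real_prism]
      · simp
      · refine ⟨fun a => by simpa using (σ.l_pos 0).le, ?_⟩
        have := mul_nonneg (show (0 : ℝ) ≤ Φ by linarith) (σ.τ_pos 1).le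
        simp only
        linarith [σ.τ_pos 0]
    refine (measureReal_mono sdiff_subset (hfin _)).trans ?_
    rw [zero_add, h1, volume_real_box, pow_zero, mul_one]
    have h2 := mul_le_mul_of_nonneg_left (σ.τ_anti zero_le_one) (show (0 : ℝ) ≤ Φ by linarith)
    have h3 := pow_pos (σ.l_pos 0) n
    calc σ.l 0 ^ n * (σ.τ 0 + Φ * σ.τ 1) ≤ σ.l 0 ^ n * (σ.τ 0 + Φ * σ.τ 0) := by gcongr
      _ = _ := by ring
  | succ N ih =>
    set lev := ℓ + (M + m) * (N + 1) with hlev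
    have hlev' : ℓ + (M + m) * (N + 1 + 1) = lev + (M + m) := by rw [hlev]; ring
    -- Here `2 ≤ M` matters: at `N = 0` the levels must already have dropped by two.
    have hge : N + 1 + 1 ≤ lev := by
      rw [hlev]; nlinarith
    have hgen := hP.generation hF hΦ (o := o) (g := N + 1) hge (fun z hz => by
      obtain ⟨w, hw, hfree⟩ := hF.holeAfter (by omega) hΦ h
        (σ.slab_anti hΦ o (by omega : 1 ≤ N + 1 + 1) hz) N
      refine ⟨w, hw, hfree.mono _ ?_⟩
      rw [hlev]
      gcongr
      omega)
    set A := σ.slab o Φ (N + 1) \ {z | σ.IsFree E o lev z} with hA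
    set F : Set ((Fin n → ℝ) × ℝ) := {z | σ.IsFree E o (lev + (M + m)) z} with hFd
    have hAfin : volume A ≠ ⊤ := measure_ne_top_of_subset sdiff_subset (hfin _)
    rw [hlev']
    set B := σ.slab o Φ (N + 1 + 1) \ F with hB
    have hslab := σ.slab_anti hΦ o (by omega : N + 1 ≤ N + 1 + 1)
    have hBA : B ⊆ A \ F := fun z hz => ⟨⟨hslab hz.1, fun hf => hz.2 (hf.mono _ (by omega))⟩, hz.2⟩
    have hBA' : B ⊆ σ.slab o Φ (N + 1 + 1) \ {z | σ.IsFree E o lev z} :=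
      fun z hz => ⟨hz.1, fun hf => hz.2 (hf.mono _ (by omega))⟩
    have hreal : c * volume.real B ≤ (Φ + 1) * volume.real (A ∩ F) := by
      have h1 : ENNReal.ofReal c * volume B ≤ ENNReal.ofReal (Φ + 1) * volume (A ∩ F) :=
        le_trans (by gcongr) hgen
      have h2 := ENNReal.toReal_mono (ENNReal.mul_ne_top ENNReal.ofReal_ne_top
        (measure_ne_top_of_subset inter_subset_left hAfin)) h1
      rwa [ENNReal.toReal_mul, ENNReal.toReal_mul, ENNReal.toReal_ofReal hc.le,
        ENNReal.toReal_ofReal (by linarith)] at h2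
    have hsplit : volume.real (A ∩ F) + volume.real (A \ F) = volume.real A :=
      measureReal_inter_add_sdiff (σ.measurableSet_isFree _ _ _) hAfin
    have hB2 : volume.real B ≤ volume.real (A \ F) :=
      measureReal_mono hBA (measure_ne_top_of_subset sdiff_subset hAfin)
    have hκ : 0 < 1 + c / (Φ + 1) := by positivity
    have hfinal : (1 + c / (Φ + 1)) * volume.real B ≤ volume.real A := by
      have : c / (Φ + 1) * volume.real B ≤ volume.real (A ∩ F) := by
        rw [div_mul_eq_mul_div, div_le_iff₀ (by linarith)]
        linarith
      linarith
    calc volume.real B ≤ (1 + c / (Φ + 1))⁻¹ * volume.real A := by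
          rw [inv_mul_eq_div, le_div_iff₀ hκ]; linarith
      _ ≤ (1 + c / (Φ + 1))⁻¹ * ((Φ + 1) * volume.real (σ.box o 0) *
          ((1 + c / (Φ + 1))⁻¹) ^ N) := by gcongr
      _ = _ := by rw [pow_succ]; ring

end Scales

end Parabolic

/-! ### Dyadic layers of rectangles as grid cells. -/

namespace Parabolic

open MeasureTheory Set

open Classical in
/-- Number of parts of the temporal edge of a rectangle with truncation parameter `γ`. -/
noncomputable def divisions (p : ℝ) (d : ℕ) (γ : ℝ) : ℕ :=
  if γ ≤ 1 - ((2 : ℝ) ^ (d * p) + 1) / (2 : ℝ) ^ (d * p + 1) then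
    ⌈(2 : ℝ) ^ (d * p)⌉₊
  else
    ⌊(2 : ℝ) ^ (d * p)⌋₊

/-- Truncation parameters of the layers of a rectangle with truncation parameter `γ`. -/
noncomputable def truncation (p : ℝ) (d : ℕ) (γ : ℝ) : ℕ → ℝ
  | 0 => γ
  | i + 1 => 1 - (1 - truncation p d γ i) * (2 : ℝ) ^ (d * p) / divisions p d (truncation p d γ i)

theorem nine_le_divisions {p : ℝ} {d : ℕ} (hX : 9 ≤ (2 : ℝ) ^ (d * p)) (γ : ℝ) :
    9 ≤ divisions p d γ := by
  have h : 9 ≤ ⌊(2 : ℝ) ^ (d * p)⌋₊ := Nat.le_floor (by exact_mod_cast hX)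
  unfold divisions
  split_ifs
  · exact h.trans (Nat.floor_le_ceil _)
  · exact h

theorem divisions_le (p : ℝ) (d : ℕ) (γ : ℝ) : divisions p d γ ≤ ⌈(2 : ℝ) ^ (d * p)⌉₊ := by
  unfold divisions
  split_ifs
  · exact le_rfl
  · exact Nat.floor_le_ceil _

/-- With X = 2 ^ (d p), the threshold on γ says (1 - γ) X ≥ (X + 1) / 2. Above it, rounding X up
keeps the child's relative length at least 1/2; below it, rounding down keeps that length at most 1.
-/
theorem truncation_mem {p : ℝ} {d : ℕ} (hX : 9 ≤ (2 : ℝ) ^ (d * p)) {γ : ℝ}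
    (hγ : γ ∈ Icc (0 : ℝ) (1 / 2)) (i : ℕ) : truncation p d γ i ∈ Icc (0 : ℝ) (1 / 2) := by
  induction i with
  | zero => exact hγ
  | succ i ih =>
    rw [truncation]
    set β := truncation p d γ i
    have h9 : (9 : ℝ) ≤ divisions p d β := by exact_mod_cast nine_le_divisions hX β
    obtain ⟨h0, h1⟩ := ih
    have key : (divisions p d β : ℝ) / 2 ≤ (1 - β) * (2 : ℝ) ^ (d * p) ∧
        (1 - β) * (2 : ℝ) ^ (d * p) ≤ divisions p d β := by
      have e : (2 : ℝ) ^ (d * p + 1) = 2 * (2 : ℝ) ^ (d * p) := by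
        rw [Real.rpow_add (by norm_num), Real.rpow_one, mul_comm]
      unfold divisions
      rw [e]
      set X := (2 : ℝ) ^ (d * p)
      have hX0 : 0 < X := by linarith
      split_ifs with h
      · have hc := Nat.ceil_lt_add_one hX0.le
        have hc' := Nat.le_ceil X
        have h2 : (X + 1) / (2 * X) * X = (X + 1) / 2 := by field_simp
        constructor
        · nlinarith
        · nlinarith
      · have hf := Nat.floor_le hX0.le
        have hf' := Nat.lt_floor_add_one X
        have h2 : (X + 1) / (2 * X) * X = (X + 1) / 2 := by field_simp
        push Not at h
        constructor
        · nlinarith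
        · nlinarith
    have hpos : (0 : ℝ) < divisions p d β := by linarith
    constructor
    · rw [sub_nonneg, div_le_one hpos]
      exact key.2
    · rw [sub_le_comm, le_div_iff₀ hpos]
      linarith [key.1]

theorem div_two_pow_rpow {L : ℝ} (hL : 0 < L) (p : ℝ) (d : ℕ) :
    L ^ p = (2 : ℝ) ^ (d * p) * (L / 2 ^ d) ^ p := by
  rw [Real.div_rpow hL.le (by positivity), ← Real.rpow_natCast, ← Real.rpow_mul (by norm_num)]
  have : (2 : ℝ) ^ (d * p) ≠ 0 := (Real.rpow_pos_of_pos (by norm_num) _).ne'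
  field_simp

/-- Side lengths of the layers of a rectangle. -/
noncomputable def layerScales (p : ℝ) (d : ℕ) (L γ : ℝ) (hX : 9 ≤ (2 : ℝ) ^ (d * p)) (hL : 0 < L)
    (hγ : γ ∈ Icc (0 : ℝ) (1 / 2)) : Scales p d ⌈(2 : ℝ) ^ (d * p)⌉₊ where
  l i := L / (2 ^ d) ^ i
  τ i := (1 - truncation p d γ i) * (L / (2 ^ d) ^ i) ^ p
  k i := divisions p d (truncation p d γ i)
  l_pos i := by positivity
  τ_pos i := by
    have := (truncation_mem hX hγ i).2
    have h2 : 0 < (L / (2 ^ d) ^ i) ^ p := Real.rpow_pos_of_pos (by positivity) _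
    exact mul_pos (by linarith) h2
  l_succ i := by
    push_cast
    rw [pow_succ]
    field_simp
  τ_succ i := by
    have h9 : (9 : ℝ) ≤ divisions p d (truncation p d γ i) := by
      exact_mod_cast nine_le_divisions hX _
    rw [div_two_pow_rpow (L := L / (2 ^ d) ^ i) (by positivity) p d, truncation, div_div,
      ← pow_succ]
    field_simp
    ring
  nine_le i := nine_le_divisions hX _
  k_le i := divisions_le _ _ _
  le_τ i := by
    have := (truncation_mem hX hγ i).2
    have h2 : 0 < (L / (2 ^ d) ^ i) ^ p := Real.rpow_pos_of_pos (by positivity) _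
    nlinarith
  τ_le i := by
    have := (truncation_mem hX hγ i).1
    have h2 : 0 < (L / (2 ^ d) ^ i) ^ p := Real.rpow_pos_of_pos (by positivity) _
    nlinarith

/-- The rectangle with lower corner `o`. -/
noncomputable def Rect.ofCorner {n : ℕ} (p L γ : ℝ) (o : (Fin n → ℝ) × ℝ) : Rect n :=
  ⟨fun a => o.1 a + L / 2, o.2 + L ^ p, L, γ⟩

/-- The lower corner of a rectangle. -/
noncomputable def Rect.corner {n : ℕ} (p : ℝ) (R : Rect n) : (Fin n → ℝ) × ℝ :=
  (fun a => R.x a - R.L / 2, R.t - R.L ^ p)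

theorem Rect.ofCorner_corner {n : ℕ} (p : ℝ) (R : Rect n) :
    Rect.ofCorner p R.L R.γ (R.corner p) = R := by
  cases R
  simp [ofCorner, corner]

/-- The rectangle of level `i` with lower corner `o`. -/
noncomputable def levelRect {n : ℕ} (p : ℝ) (d : ℕ) (L γ : ℝ) (i : ℕ) (o : (Fin n → ℝ) × ℝ) : Rect n :=
  Rect.ofCorner p (L / (2 ^ d) ^ i) (truncation p d γ i) o

theorem levelRect_valid {p : ℝ} {d n : ℕ} {L γ : ℝ} (hX : 9 ≤ (2 : ℝ) ^ (d * p)) (hL : 0 < L)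
    (hγ : γ ∈ Icc (0 : ℝ) (1 / 2)) (i : ℕ) (o : (Fin n → ℝ) × ℝ) :
    (levelRect p d L γ i o).Valid :=
  ⟨(layerScales p d L γ hX hL hγ).l_pos i, truncation_mem hX hγ i⟩

section layers

variable {p : ℝ} {d n : ℕ} {L γ : ℝ} (hX : 9 ≤ (2 : ℝ) ^ (d * p)) (hL : 0 < L)
  (hγ : γ ∈ Icc (0 : ℝ) (1 / 2))

local notation "Λ" => layerScales p d L γ hX hL hγ

theorem levelRect_toSet (i : ℕ) (o : (Fin n → ℝ) × ℝ) :
    (levelRect p d L γ i o).toSet p = (Λ).box o i := by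
  ext z
  have : o.2 + (L / (2 ^ d) ^ i) ^ p - truncation p d γ i * (L / (2 ^ d) ^ i) ^ p =
      o.2 + (1 - truncation p d γ i) * (L / (2 ^ d) ^ i) ^ p := by ring
  rw [Scales.mem_box]
  simp only [levelRect, Rect.ofCorner, Rect.toSet, mem_prod, mem_pi, mem_univ, true_imp_iff,
    mem_Ico, add_sub_cancel_right, add_assoc, add_halves, layerScales, this]

theorem levelRect_vol (i : ℕ) (o : (Fin n → ℝ) × ℝ) :
    (levelRect p d L γ i o).vol p = (Λ).l i ^ n * (Λ).τ i := by
  rw [Rect.vol, levelRect_toSet hX hL hγ, Scales.volume_real_box]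

theorem levelRect_translate (i : ℕ) (o : (Fin n → ℝ) × ℝ) (s : ℝ) :
    (levelRect p d L γ i o).translate p s =
      levelRect p d L γ i (Scales.later o (s * (Λ).τ i)) := by
  simp only [levelRect, Rect.ofCorner, Rect.translate, Rect.lt, Scales.later, layerScales,
    Rect.mk.injEq, and_true, true_and]
  ring

theorem levelRect_child (i : ℕ) (o : (Fin n → ℝ) × ℝ) (j : Fin n → Fin (2 ^ d)) (m : ℕ) :
    (levelRect p d L γ i o).child p d j m =
      levelRect p d L γ (i + 1) ((Λ).node o (i + 1) (fun a => ((j a : ℕ) : ℤ), (m : ℤ))) := by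
  have h1 : L / (2 ^ d) ^ i / 2 ^ d = L / (2 ^ d) ^ (i + 1) := by rw [div_div, ← pow_succ]
  have h2 := (Λ).τ_succ i
  have h3 : ((Λ).k i : ℝ) ≠ 0 := by
    have := (Λ).nine_le i
    positivity
  have h4 : (Λ).τ (i + 1) = (Λ).τ i / (Λ).k i := by rw [h2]; field_simp
  rw [Rect.child, levelRect, Rect.ofCorner, levelRect, Rect.ofCorner]
  simp only [Rect.mk.injEq]
  refine ⟨?_, ?_, h1, rfl⟩
  · ext a
    simp only [Scales.node, layerScales, h1]
    push_cast
    ring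
  · rw [h1]
    simp only [Scales.node, h4]
    rw [add_sub_cancel_right]
    rfl

/-- The rectangles of a layer are cells of the grid of that level. -/
theorem exists_eq_of_mem_layer (i q : ℕ) (o : (Fin n → ℝ) × ℝ) (P : Rect n)
    (hP : P ∈ (levelRect p d L γ i o).dyadicLayer p d q) :
    (∃ v, P = levelRect p d L γ (i + q) ((Λ).node o (i + q) v)) ∧ P.toSet p ⊆ (Λ).box o i := by
  induction q generalizing P with
  | zero =>
    rw [Rect.dyadicLayer, mem_singleton_iff] at hP
    rw [hP, levelRect_toSet hX hL hγ]
    refine ⟨⟨0, ?_⟩, Subset.rfl⟩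
    congr 1
    ext <;> simp [Scales.node]
  | succ q ih =>
    rw [Rect.dyadicLayer, mem_iUnion₂] at hP
    obtain ⟨P', hP', j, m, hm, rfl⟩ := hP
    obtain ⟨⟨v, rfl⟩, hsub⟩ := ih P' hP'
    rw [levelRect_child hX hL hγ]
    set o' := (Λ).node o (i + q) v
    constructor
    · obtain ⟨w, hw⟩ := ((Λ).aligned_node (Nat.le_succ (i + q)) o v).trans _
        ((Λ).aligned_node le_rfl o' (fun a => ((j a : ℕ) : ℤ), (m : ℤ)))
      exact ⟨w, by rw [hw]; rfl⟩
    · refine Subset.trans ?_ hsub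
      rw [levelRect_toSet hX hL hγ, levelRect_toSet hX hL hγ]
      intro z hz
      rw [Scales.mem_box] at hz ⊢
      simp only [Scales.node] at hz
      have hl := (Λ).l_succ (i + q)
      have hτ := (Λ).τ_succ (i + q)
      have hl0 := (Λ).l_pos (i + q + 1)
      have hτ0 := (Λ).τ_pos (i + q + 1)
      refine ⟨fun a => ?_, ?_⟩
      · have h1 := hz.1 a
        have h2 : ((j a : ℕ) : ℝ) + 1 ≤ ((2 ^ d : ℕ) : ℝ) := by exact_mod_cast (j a).2
        have h3 : (0 : ℝ) ≤ ((j a : ℕ) : ℝ) := Nat.cast_nonneg _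
        rw [Int.cast_natCast] at h1
        rw [hl]
        constructor <;> nlinarith
      · have h1 := hz.2
        have h2 : (m : ℝ) + 1 ≤ (Λ).k (i + q) := by exact_mod_cast hm
        have h3 : (0 : ℝ) ≤ m := Nat.cast_nonneg _
        rw [Int.cast_natCast] at h1
        rw [hτ]
        constructor <;> nlinarith

theorem exists_mem_layer (i q : ℕ) {o z : (Fin n → ℝ) × ℝ} (hz : z ∈ (Λ).box o i) :
    ∃ P ∈ (levelRect p d L γ i o).dyadicLayer p d q, z ∈ P.toSet p := by
  induction q with
  | zero => exact ⟨_, rfl, by rwa [levelRect_toSet hX hL hγ]⟩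
  | succ q ih =>
    obtain ⟨P, hP, hzP⟩ := ih
    obtain ⟨⟨v, rfl⟩, -⟩ := exists_eq_of_mem_layer hX hL hγ i q o P hP
    set o' := (Λ).node o (i + q) v with ho'
    rw [levelRect_toSet hX hL hγ, Scales.mem_box] at hzP
    have hl := (Λ).l_succ (i + q)
    have hτ := (Λ).τ_succ (i + q)
    have hl0 := (Λ).l_pos (i + q + 1)
    have hτ0 := (Λ).τ_pos (i + q + 1)
    have hA : ∀ a, ∃ j : Fin (2 ^ d), ((j : ℕ) : ℤ) = ((Λ).index o' (i + q + 1) z).1 a := by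
      intro a
      have h1 := hzP.1 a
      have h0 : 0 ≤ ((Λ).index o' (i + q + 1) z).1 a :=
        Int.floor_nonneg.2 (div_nonneg (by linarith) hl0.le)
      have h2 : ((Λ).index o' (i + q + 1) z).1 a < ((2 ^ d : ℕ) : ℤ) := by
        refine Int.floor_lt.2 ?_
        rw [div_lt_iff₀ hl0, Int.cast_natCast, ← hl]
        linarith
      obtain ⟨b, hb⟩ := Int.eq_ofNat_of_zero_le h0
      exact ⟨⟨b, by omega⟩, hb.symm⟩
    choose j hj using hA
    have h0 : 0 ≤ ((Λ).index o' (i + q + 1) z).2 :=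
      Int.floor_nonneg.2 (div_nonneg (by linarith) hτ0.le)
    have h2 : ((Λ).index o' (i + q + 1) z).2 < ((Λ).k (i + q) : ℤ) := by
      refine Int.floor_lt.2 ?_
      rw [div_lt_iff₀ hτ0, Int.cast_natCast, ← hτ]
      linarith
    obtain ⟨m, hm⟩ := Int.eq_ofNat_of_zero_le h0
    refine ⟨(levelRect p d L γ (i + q) o').child p d j m, ?_, ?_⟩
    · rw [Rect.dyadicLayer, mem_iUnion₂]
      refine ⟨_, hP, j, m, ?_, rfl⟩
      have : m < (Λ).k (i + q) := by omega
      exact this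
    · rw [levelRect_child hX hL hγ, levelRect_toSet hX hL hγ, Scales.mem_cell]
      ext a
      · exact (hj a).symm
      · exact hm

theorem Rect.finite_dyadicLayer (R : Rect n) (q : ℕ) : (R.dyadicLayer p d q).Finite := by
  induction q with
  | zero => exact finite_singleton R
  | succ q ih =>
    rw [Rect.dyadicLayer]
    refine ih.biUnion fun P _ => ?_
    refine (finite_range fun x : (Fin n → Fin (2 ^ d)) × Fin (P.timeDivisions p d) =>
      P.child p d x.1 x.2).subset ?_
    rintro _ ⟨j, m, hm, rfl⟩
    exact ⟨(j, ⟨m, hm⟩), rfl⟩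

variable {E : Set ((Fin n → ℝ) × ℝ)}

theorem isFree_iff_disjoint {o z : (Fin n → ℝ) × ℝ} {i : ℕ} :
    (Λ).IsFree E o i z ↔ Disjoint ((Λ).cell o i z) E := by
  rw [Set.disjoint_right]
  simp only [Scales.IsFree, Scales.mem_cell_iff, ne_eq]

/-- A dyadic subrectangle is the cell of each of its points. -/
theorem toSet_eq_cell {i q : ℕ} {o z : (Fin n → ℝ) × ℝ} {P : Rect n}
    (hP : P ∈ (levelRect p d L γ i o).dyadicLayer p d q) (hz : z ∈ P.toSet p) :
    P.toSet p = (Λ).cell o (i + q) z := by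
  obtain ⟨⟨v, rfl⟩, -⟩ := exists_eq_of_mem_layer hX hL hγ i q o P hP
  rw [levelRect_toSet hX hL hγ] at hz ⊢
  rw [Scales.mem_cell] at hz
  rw [Scales.cell, hz]

theorem exists_point_of_mem_layer {i q : ℕ} {o : (Fin n → ℝ) × ℝ} {P : Rect n}
    (hP : P ∈ (levelRect p d L γ i o).dyadicLayer p d q) :
    ∃ z ∈ (Λ).box o i, P.toSet p = (Λ).cell o (i + q) z ∧ P.L = (Λ).l (i + q) ∧
      P.vol p = (Λ).l (i + q) ^ n * (Λ).τ (i + q) := by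
  obtain ⟨⟨v, hv⟩, hsub⟩ := exists_eq_of_mem_layer hX hL hγ i q o P hP
  have hmem : (Λ).node o (i + q) v ∈ P.toSet p := by
    rw [hv, levelRect_toSet hX hL hγ, Scales.mem_box]
    have h1 := (Λ).l_pos (i + q)
    have h2 := (Λ).τ_pos (i + q)
    exact ⟨fun a => ⟨le_rfl, by linarith⟩, le_rfl, by linarith⟩
  refine ⟨_, hsub hmem, toSet_eq_cell hX hL hγ hP hmem, ?_, ?_⟩
  · rw [hv]; rfl
  · rw [hv, levelRect_vol hX hL hγ]

theorem mem_freeRects_levelRect {i : ℕ} {o : (Fin n → ℝ) × ℝ} {P : Rect n}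
    (hP : P ∈ freeRects p d E (levelRect p d L γ i o)) :
    ∃ q, ∃ z ∈ (Λ).box o i, (Λ).IsFree E o (i + q) z ∧ P.toSet p = (Λ).cell o (i + q) z ∧
      P.L = (Λ).l (i + q) ∧ P.vol p = (Λ).l (i + q) ^ n * (Λ).τ (i + q) := by
  obtain ⟨hlat, hdisj⟩ := hP
  obtain ⟨q, hq⟩ := mem_iUnion.1 hlat
  obtain ⟨z, hz, h1, h2⟩ := exists_point_of_mem_layer hX hL hγ hq
  exact ⟨q, z, hz, (isFree_iff_disjoint hX hL hγ).2 (h1 ▸ hdisj), h1, h2⟩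

theorem exists_freeRect {i q : ℕ} {o z : (Fin n → ℝ) × ℝ} (hz : z ∈ (Λ).box o i)
    (hfree : (Λ).IsFree E o (i + q) z) :
    ∃ P ∈ freeRects p d E (levelRect p d L γ i o), P.toSet p = (Λ).cell o (i + q) z ∧
      P.L = (Λ).l (i + q) := by
  obtain ⟨P, hP, hzP⟩ := exists_mem_layer hX hL hγ i q hz
  have h1 := toSet_eq_cell hX hL hγ hP hzP
  obtain ⟨-, -, -, h2, -⟩ := exists_point_of_mem_layer hX hL hγ hP
  exact ⟨P, ⟨mem_iUnion.2 ⟨q, hP⟩, h1 ▸ (isFree_iff_disjoint hX hL hγ).1 hfree⟩, h1, h2⟩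

/-- The volume of the maximal hole is that of the cells of the first layer which contains a free
one. -/
theorem volume_maximalHole (hd : 1 ≤ d) {i : ℕ} {o : (Fin n → ℝ) × ℝ}
    (h : ∃ q, ∃ z ∈ (Λ).box o i, (Λ).IsFree E o (i + q) z) :
    ∃ q, (∃ z ∈ (Λ).box o i, (Λ).IsFree E o (i + q) z) ∧
      volume.real (maximalHole p d E (levelRect p d L γ i o)) =
        (Λ).l (i + q) ^ n * (Λ).τ (i + q) ∧
      ∀ q', (∃ z ∈ (Λ).box o i, (Λ).IsFree E o (i + q') z) → q ≤ q' := by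
  classical
  have hspec := Nat.find_spec h
  have hmin : ∀ q', (∃ z ∈ (Λ).box o i, (Λ).IsFree E o (i + q') z) → Nat.find h ≤ q' :=
    fun q' hq' => Nat.find_min' h hq'
  set q := Nat.find h
  obtain ⟨z, hz, hfree⟩ := hspec
  obtain ⟨P, hP, hPset, hPL⟩ := exists_freeRect hX hL hγ hz hfree
  have hPmax : P ∈ maximalFreeRects p d E (levelRect p d L γ i o) := by
    refine ⟨hP, fun Q hQ hPQ => ?_⟩
    obtain ⟨q', z', hz', hfree', hQset, -⟩ := mem_freeRects_levelRect hX hL hγ hQ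
    have hqq := hmin q' ⟨z', hz', hfree'⟩
    rw [hPset, hQset] at hPQ ⊢
    have hzz : z ∈ (Λ).cell o (i + q') z' := hPQ ((Λ).mem_cell_self o z _)
    have hzz' : z' ∈ (Λ).cell o (i + q) z := by
      rw [Scales.mem_cell_iff] at hzz ⊢
      exact (Λ).index_coarsen (by omega) hzz.symm
    exact (Λ).cell_subset (by omega) hzz'
  have hlarge : IsLargestHole p d E (levelRect p d L γ i o) P := by
    refine ⟨hPmax, fun Q hQ => ?_⟩
    obtain ⟨q', z', hz', hfree', -, hQL, -⟩ := mem_freeRects_levelRect hX hL hγ hQ.1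
    rw [hQL, hPL]
    exact (Λ).l_anti (by have := hmin q' ⟨z', hz', hfree'⟩; omega)
  have hex : ∃ M, IsLargestHole p d E (levelRect p d L γ i o) M := ⟨P, hlarge⟩
  refine ⟨q, ⟨z, hz, hfree⟩, ?_, hmin⟩
  have hM := hex.choose_spec
  rw [maximalHole, dif_pos hex]
  set M := hex.choose
  obtain ⟨q', z', hz', hfree', -, hML, hMvol⟩ := mem_freeRects_levelRect hX hL hγ hM.1.1
  have hqq := hmin q' ⟨z', hz', hfree'⟩
  have hle : (Λ).l (i + q) ≤ (Λ).l (i + q') := by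
    rw [← hML, ← hPL]
    exact hM.2 P hPmax
  -- The chosen hole need not be `P`, but side lengths strictly decrease with the level as `d ≥ 1`,
  -- so it has the same level.
  have : q' = q := by
    by_contra hne
    obtain ⟨r, rfl⟩ := Nat.exists_eq_add_of_lt (lt_of_le_of_ne hqq (Ne.symm hne))
    have h1 := (Λ).l_succ (i + q)
    have h2 := (Λ).l_anti (show i + q + 1 ≤ i + (q + r + 1) by omega)
    have h3 : (2 : ℝ) ≤ ((2 ^ d : ℕ) : ℝ) := by
      exact_mod_cast Nat.le_self_pow (by omega) 2
    have h4 := (Λ).l_pos (i + q + 1)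
    nlinarith
  rw [← this]
  exact hMvol

end layers

end Parabolic

/-! ### Improved constants of weak porosity. -/

namespace Parabolic

open MeasureTheory Set

namespace Scales

variable {p : ℝ} {d K : ℕ}

theorem volume_add_le (σ : Scales p d K) (n j m : ℕ) :
    σ.l (j + m) ^ n * σ.τ (j + m) * 9 ^ m ≤ σ.l j ^ n * σ.τ j := by
  obtain ⟨N, hN, -, h⟩ := σ.τ_add j m
  have h1 : (9 : ℝ) ^ m ≤ N := by exact_mod_cast hN
  have h2 := σ.l_anti (Nat.le_add_right j m)
  have h3 := σ.l_pos (j + m)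
  have h4 := σ.τ_pos (j + m)
  have h5 : 0 ≤ σ.l j ^ n := pow_nonneg (σ.l_pos j).le n
  rw [h, mul_assoc, mul_comm (N : ℝ)]
  gcongr

theorem volume_le_mul_volume_add (σ : Scales p d K) (n j m : ℕ) :
    σ.l j ^ n * σ.τ j ≤ (((2 ^ d) ^ n * K : ℕ) : ℝ) ^ m * (σ.l (j + m) ^ n * σ.τ (j + m)) := by
  obtain ⟨N, -, hN, h⟩ := σ.τ_add j m
  have h1 : (N : ℝ) ≤ (K : ℝ) ^ m := by exact_mod_cast hN
  have h3 := σ.l_pos (j + m)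
  have h4 := σ.τ_pos (j + m)
  rw [h, σ.l_add j m]
  push_cast
  calc (2 ^ (d * m) * σ.l (j + m)) ^ n * (N * σ.τ (j + m))
      ≤ (2 ^ (d * m) * σ.l (j + m)) ^ n * (K ^ m * σ.τ (j + m)) := by gcongr
    _ = _ := by
      rw [mul_pow, mul_pow, pow_mul, ← pow_mul (2 ^ d), ← pow_mul (2 ^ d), mul_comm n m]
      ring

end Scales

section layers

variable {p : ℝ} {d n : ℕ} {L γ : ℝ} (hX : 9 ≤ (2 : ℝ) ^ (d * p)) (hL : 0 < L)
  (hγ : γ ∈ Icc (0 : ℝ) (1 / 2)) {E : Set ((Fin n → ℝ) × ℝ)} {c δ : ℝ} {Φ : ℤ}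

local notation "Λ" => layerScales p d L γ hX hL hγ

/-- As c > 0, the family of holes cannot be empty. So the maximal hole is always a genuine cell. -/
theorem IsWeaklyPorous.exists_isFree {θ : ℝ} (h : IsWeaklyPorous p d E c δ θ) (i : ℕ)
    (o : (Fin n → ℝ) × ℝ) : ∃ q, ∃ z ∈ (Λ).box o i, (Λ).IsFree E o (i + q) z := by
  obtain ⟨-, -, hc, -, h⟩ := h
  have hval := levelRect_valid hX hL hγ i o
  obtain ⟨N, P, hlat, -, hfree, -, hsum⟩ := h _ hval
  have hpos : 0 < (levelRect p d L γ i o).vol p := by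
    rw [Rect.vol, levelRect_toSet hX hL hγ]
    exact (Λ).volume_real_box_pos o i
  have hN : N ≠ 0 := by
    rintro rfl
    rw [Finset.univ_eq_empty, Finset.sum_empty] at hsum
    have := mul_pos hc.1 hpos
    linarith
  obtain ⟨q, z, hz, hzf, -⟩ :=
    mem_freeRects_levelRect hX hL hγ ⟨hlat ⟨0, by omega⟩, hfree ⟨0, by omega⟩⟩
  exact ⟨q, z, hz, hzf⟩

/-- Weak porosity implies its grid version for the layers of each rectangle. -/
theorem IsWeaklyPorous.porous (h : IsWeaklyPorous p d E c δ Φ) (hd : 1 ≤ d) {m : ℕ}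
    (hm : 1 < δ * 9 ^ m) : (Λ).Porous E c m Φ := by
  intro o i j hij hz
  obtain ⟨r, rfl⟩ := Nat.exists_eq_add_of_le hij
  have hδ := h.2.2.2.1
  obtain ⟨z, hz, hfree⟩ := hz
  set o' := Scales.later o (Φ * (Λ).τ i) with ho'
  have hz' : ∃ z ∈ (Λ).box o' i, (Λ).IsFree E o' (i + r) z :=
    ⟨z, hz, ((Λ).aligned_later (by omega) o Φ).isFree_iff.2 hfree⟩
  obtain ⟨q, -, hvol, hq⟩ := volume_maximalHole hX hL hγ hd ⟨r, hz'⟩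
  have hqr := hq r hz'
  obtain ⟨N, P, hlat, hdisj, hPfree, hPvol, hsum⟩ :=
    h.2.2.2.2 _ (levelRect_valid hX hL hγ i o)
  rw [levelRect_translate hX hL hγ, hvol] at hPvol
  rw [Rect.vol, levelRect_toSet hX hL hγ] at hsum
  refine hsum.trans ?_
  have hmeas : ∀ k, MeasurableSet ((P k).toSet p) := fun k => by
    obtain ⟨_, z, -, -, hset, -⟩ := mem_freeRects_levelRect hX hL hγ ⟨hlat k, hPfree k⟩
    rw [hset]
    exact (Λ).measurableSet_box _ _
  have hfin : ∀ k, volume ((P k).toSet p) ≠ ⊤ := fun k => by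
    obtain ⟨_, z, -, -, hset, -⟩ := mem_freeRects_levelRect hX hL hγ ⟨hlat k, hPfree k⟩
    rw [hset]
    exact (Λ).volume_box_ne_top _ _
  have hU : ∑ k, (P k).vol p = volume.real (⋃ k, (P k).toSet p) := by
    rw [measureReal_iUnion_fintype hdisj hmeas hfin]
    rfl
  rw [hU]
  refine measureReal_mono (iUnion_subset fun k => ?_)
    (measure_ne_top_of_subset inter_subset_left ((Λ).volume_box_ne_top _ _))
  obtain ⟨s, hs⟩ := mem_iUnion.1 (hlat k)
  have hsub := (exists_eq_of_mem_layer hX hL hγ i s o _ hs).2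
  obtain ⟨y, -, -, -, hv⟩ := exists_point_of_mem_layer hX hL hγ hs
  intro x hx
  refine ⟨hsub hx, ?_⟩
  have hxfree : (Λ).IsFree E o (i + s) x :=
    (isFree_iff_disjoint hX hL hγ).2 (toSet_eq_cell hX hL hγ hs hx ▸ hPfree k)
  refine hxfree.mono _ ?_
  -- Volume drops by a factor at least 9 per level, so a rectangle more than `m` levels below `j`
  -- would be smaller than δ times the maximal hole, whose level is at most `j`.
  by_contra! hlt
  have h1 := hPvol k
  rw [hv] at h1
  obtain ⟨a, ha⟩ := Nat.exists_eq_add_of_lt hlt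
  obtain ⟨b, rfl⟩ := Nat.exists_eq_add_of_le hqr
  have h2 := (Λ).volume_add_le n (i + q) (m + (b + a + 1))
  rw [show i + q + (m + (b + a + 1)) = i + s by omega, pow_add] at h2
  have hpos : 0 < (Λ).l (i + s) ^ n * (Λ).τ (i + s) :=
    mul_pos (pow_pos ((Λ).l_pos _) _) ((Λ).τ_pos _)
  have h9 : (1 : ℝ) ≤ 9 ^ (b + a + 1) := one_le_pow₀ (by norm_num)
  set V := (Λ).l (i + s) ^ n * (Λ).τ (i + s)
  have h3 : V * 9 ^ m ≤ V * (9 ^ m * 9 ^ (b + a + 1)) := by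
    refine mul_le_mul_of_nonneg_left ?_ hpos.le
    exact le_mul_of_one_le_right (by positivity) h9
  have h4 := mul_le_mul_of_nonneg_left (h3.trans h2) hδ.1.le
  nlinarith

end layers

/-- Take B ^ r ≤ δ⁻¹ < B ^ (r + 1) and N = r - 1: the exponent is the one for which ρ ^ (r + 1) ≤ δ
^ α, and the factor ρ⁻¹ ^ 2 pays for r + 1 - N = 2. The first alternative covers δ too large for a
useful N, when the right side is already at least 1. -/
theorem exists_division {c : ℝ} {ρ B A δ : ℝ} (hρ : ρ ∈ Ioo (0 : ℝ) 1) (hB : 1 < B) (hA : 1 ≤ A)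
    (hδ : δ ∈ Ioo (0 : ℝ) 1) (hc : 0 < c) :
    1 - c ≤ A * ρ⁻¹ ^ 2 * δ ^ (-Real.log ρ / Real.log B) ∨
    ∃ N : ℕ, δ * B ^ (N + 1) ≤ 1 ∧ A * ρ ^ N < 1 ∧
      A * ρ ^ N ≤ A * ρ⁻¹ ^ 2 * δ ^ (-Real.log ρ / Real.log B) := by
  obtain ⟨r, hr1, hr2⟩ := exists_nat_pow_near (x := δ⁻¹) ((one_le_inv₀ hδ.1).2 hδ.2.le) hB
  have hBpos : 0 < B := by linarith
  have hlogB : 0 < Real.log B := Real.log_pos hB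
  have hpow : ρ ^ (r + 1) ≤ δ ^ (-Real.log ρ / Real.log B) := by
    have hlogδ : -Real.log δ ≤ (r + 1) * Real.log B := by
      have := Real.log_le_log (inv_pos.2 hδ.1) hr2.le
      rw [Real.log_inv, Real.log_pow] at this
      exact_mod_cast this
    have hlogρ : Real.log ρ < 0 := Real.log_neg hρ.1 hρ.2
    rw [← Real.log_le_log_iff (pow_pos hρ.1 _) (Real.rpow_pos_of_pos hδ.1 _), Real.log_pow,
      Real.log_rpow hδ.1, div_mul_eq_mul_div, le_div_iff₀ hlogB]
    push_cast
    nlinarith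
  have hAr : A * (ρ⁻¹ ^ 2 * ρ ^ (r + 1)) ≤ A * ρ⁻¹ ^ 2 * δ ^ (-Real.log ρ / Real.log B) := by
    rw [← mul_assoc]
    have := inv_pos.2 hρ.1
    gcongr
  have hρ0 := hρ.1
  rcases Nat.eq_zero_or_pos r with rfl | hrpos
  · left
    have h1 : ρ⁻¹ ^ 2 * ρ ^ (0 + 1) = ρ⁻¹ := by
      rw [zero_add, pow_one]
      field_simp
    have h2 : 1 ≤ ρ⁻¹ := (one_le_inv₀ hρ0).2 hρ.2.le
    rw [h1] at hAr
    nlinarith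
  · obtain ⟨N, rfl⟩ := Nat.exists_eq_succ_of_ne_zero hrpos.ne'
    have h1 : ρ⁻¹ ^ 2 * ρ ^ (N + 1 + 1) = ρ ^ N := by
      rw [show N + 1 + 1 = 2 + N by omega, pow_add]
      field_simp
    rw [Nat.succ_eq_add_one, h1] at hAr
    rcases lt_or_ge (A * ρ ^ N) 1 with hlt | hge
    · refine Or.inr ⟨N, ?_, hlt, hAr⟩
      have := mul_le_mul_of_nonneg_left hr1 hδ.1.le
      rwa [mul_inv_cancel₀ hδ.1.ne'] at this
    · left
      linarith

/-- Iterating over the generations of holes improves the constants of weak porosity. -/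
theorem IsWeaklyPorous.improve {p : ℝ} {d n : ℕ} (hX : 9 ≤ (2 : ℝ) ^ (d * p)) (hd : 1 ≤ d)
    {E : Set ((Fin n → ℝ) × ℝ)} {c₀ δ₀ : ℝ} {Φ : ℤ} (hΦ : 2 ≤ Φ)
    (h : IsWeaklyPorous p d E c₀ δ₀ Φ) {m M : ℕ} (hm : 1 < δ₀ * 9 ^ m) (hM : 2 ≤ M)
    (hF : ∀ σ : Scales p d ⌈(2 : ℝ) ^ (d * p)⌉₊, σ.Porous E c₀ m Φ → σ.Flows E M Φ)
    {δ : ℝ} (hδ : δ ∈ Ioo (0 : ℝ) 1) {N : ℕ}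
    (hδN : δ * ((((2 ^ d) ^ n * ⌈(2 : ℝ) ^ (d * p)⌉₊ : ℕ) : ℝ) ^ (M + m)) ^ (N + 1) ≤ 1)
    (hlt : (Φ + 1 : ℝ) * (1 + c₀ / (Φ + 1))⁻¹ ^ N < 1) :
    IsWeaklyPorous p d E (1 - (Φ + 1) * (1 + c₀ / (Φ + 1))⁻¹ ^ N) δ Φ := by
  have hΦ' : (2 : ℝ) ≤ Φ := by exact_mod_cast hΦ
  have hc₀ := h.2.2.1.1
  have hpos : 0 < (Φ + 1 : ℝ) * (1 + c₀ / (Φ + 1))⁻¹ ^ N := by positivity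
  refine ⟨h.1, h.2.1, ⟨by linarith, by linarith⟩, hδ, fun R hR => ?_⟩
  set o := R.corner p with ho
  have hL := hR.1
  have hγ : R.γ ∈ Icc (0 : ℝ) (1 / 2) := hR.2
  have hRo : R = levelRect p d R.L R.γ 0 o := by
    conv_lhs => rw [← Rect.ofCorner_corner p R]
    simp [levelRect, truncation, ho]
  set σ := layerScales p d R.L R.γ hX hL hγ with hσ
  have hpor : σ.Porous E c₀ m Φ := h.porous hX hL hγ hd hm
  set o' := Scales.later o (Φ * σ.τ 0) with ho'
  obtain ⟨q, hq, hvol, -⟩ := volume_maximalHole hX hL hγ hd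
    (h.exists_isFree hX hL hγ 0 o')
  rw [zero_add] at hvol
  have hq' : ∃ w ∈ σ.box o' 0, σ.IsFree E o q w := by
    obtain ⟨w, hw, hfree⟩ := hq
    rw [zero_add] at hfree
    exact ⟨w, hw, (σ.aligned_later (Nat.zero_le q) o Φ).isFree_iff.1 hfree⟩
  have hdecay := hpor.decay hc₀ (hF σ hpor) hM hΦ hq' N
  set lev := q + (M + m) * (N + 1) with hlev
  -- A single layer suffices: its rectangles are disjoint and have equal volume, and finer free
  -- cells include all coarser holes.
  set S : Set (Rect n) := {P | P ∈ R.dyadicLayer p d lev ∧ Disjoint (P.toSet p) E} with hS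
  have hSfin : S.Finite := (R.finite_dyadicLayer lev).subset fun P hP => hP.1
  have hlay : ∀ P ∈ S, ∃ z ∈ σ.box o 0, P.toSet p = σ.cell o lev z ∧
      P.vol p = σ.l lev ^ n * σ.τ lev := by
    intro P hP
    have hP1 := hP.1
    rw [hRo] at hP1
    obtain ⟨z, hz, h1, -, h2⟩ := exists_point_of_mem_layer hX hL hγ hP1
    rw [zero_add] at h1 h2
    exact ⟨z, hz, h1, h2⟩
  have hdisj : ∀ P ∈ S, ∀ Q ∈ S, P ≠ Q → Disjoint (P.toSet p) (Q.toSet p) := by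
    intro P hP Q hQ hne
    have hP1 := hP.1
    have hQ1 := hQ.1
    rw [hRo] at hP1 hQ1
    obtain ⟨⟨v, hv⟩, -⟩ := exists_eq_of_mem_layer hX hL hγ 0 lev o P hP1
    obtain ⟨⟨w, hw⟩, -⟩ := exists_eq_of_mem_layer hX hL hγ 0 lev o Q hQ1
    rw [Set.disjoint_left]
    intro x hx hx'
    rw [hv, levelRect_toSet hX hL hγ, Scales.mem_cell] at hx
    rw [hw, levelRect_toSet hX hL hγ, Scales.mem_cell] at hx'
    exact hne (by rw [hv, hw, ← hx, ← hx'])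
  have hRset : R.toSet p = σ.box o 0 := by
    conv_lhs => rw [hRo]
    exact levelRect_toSet hX hL hγ 0 o
  have hSfin' := hSfin.to_subtype
  obtain ⟨k, ⟨e⟩⟩ := Finite.exists_equiv_fin S
  refine ⟨k, fun a => (e.symm a : Rect n), fun a => mem_iUnion.2 ⟨lev, (e.symm a).2.1⟩, ?_,
    fun a => (e.symm a).2.2, fun a => ?_, ?_⟩
  · intro a b hab
    exact hdisj _ (e.symm a).2 _ (e.symm b).2 fun heq =>
      hab (e.symm.injective (Subtype.ext heq))
  · obtain ⟨-, -, -, hv⟩ := hlay _ (e.symm a).2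
    have htr : R.translate p Φ = levelRect p d R.L R.γ 0 o' := by
      conv_lhs => rw [hRo]
      exact levelRect_translate hX hL hγ 0 o Φ
    rw [hv, htr, hvol]
    -- `lev` lies (M + m)(N + 1) levels below the maximal hole of the translate, so `hδN` is the
    -- required lower volume bound.
    have h1 := σ.volume_le_mul_volume_add n q ((M + m) * (N + 1))
    rw [← hlev, pow_mul] at h1
    have hv0 : 0 < σ.l lev ^ n * σ.τ lev := mul_pos (pow_pos (σ.l_pos _) _) (σ.τ_pos _)
    have h2 := mul_le_mul_of_nonneg_left h1 hδ.1.le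
    have h3 := mul_le_mul_of_nonneg_right hδN hv0.le
    linarith
  · have hmeas : ∀ a, MeasurableSet ((e.symm a : Rect n).toSet p) := fun a => by
      obtain ⟨z, -, hset, -⟩ := hlay _ (e.symm a).2
      rw [hset]
      exact σ.measurableSet_box _ _
    have hfin : ∀ a, volume ((e.symm a : Rect n).toSet p) ≠ ⊤ := fun a => by
      obtain ⟨z, -, hset, -⟩ := hlay _ (e.symm a).2
      rw [hset]
      exact σ.volume_box_ne_top _ _
    have hU : ∑ a, (e.symm a : Rect n).vol p = volume.real (⋃ a, (e.symm a : Rect n).toSet p) := by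
      rw [measureReal_iUnion_fintype _ hmeas hfin]
      · rfl
      · intro a b hab
        exact hdisj _ (e.symm a).2 _ (e.symm b).2 fun heq =>
          hab (e.symm.injective (Subtype.ext heq))
    have hUfin : volume (⋃ a, (e.symm a : Rect n).toSet p) ≠ ⊤ := by
      refine ((measure_iUnion_fintype_le _ _).trans_lt ?_).ne
      exact ENNReal.sum_lt_top.2 fun a _ => (hfin a).lt_top
    have hsub : σ.box o 0 ∩ {z | σ.IsFree E o lev z} ⊆ ⋃ a, (e.symm a : Rect n).toSet p := by
      rintro z ⟨hz, hfree⟩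
      obtain ⟨P, hP, hzP⟩ := exists_mem_layer hX hL hγ 0 lev hz
      have hset := toSet_eq_cell hX hL hγ hP hzP
      rw [zero_add] at hset
      rw [← hRo] at hP
      have hPS : P ∈ S := ⟨hP, hset ▸ (isFree_iff_disjoint hX hL hγ).1 hfree⟩
      exact mem_iUnion.2 ⟨e ⟨P, hPS⟩, by simpa using hzP⟩
    have hsplit : volume.real (σ.box o 0 ∩ {z | σ.IsFree E o lev z}) +
        volume.real (σ.box o 0 \ {z | σ.IsFree E o lev z}) = volume.real (σ.box o 0) :=
      measureReal_inter_add_sdiff (σ.measurableSet_isFree _ _ _) (σ.volume_box_ne_top _ _)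
    have hrest : volume.real (σ.box o 0 \ {z | σ.IsFree E o lev z}) ≤
        volume.real (σ.slab o Φ (N + 1) \ {z | σ.IsFree E o lev z}) := by
      refine measureReal_mono (sdiff_subset_sdiff_left fun z hz => ?_)
        (measure_ne_top_of_subset sdiff_subset (volume_prism_ne_top _ _))
      rw [Scales.mem_box] at hz
      rw [Scales.mem_slab]
      have := mul_pos (show (0 : ℝ) < Φ by linarith) (σ.τ_pos (N + 1))
      exact ⟨hz.1, hz.2.1, by linarith [hz.2.2]⟩
    rw [hU, Rect.vol, hRset]
    refine le_trans ?_ (measureReal_mono hsub hUfin)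
    linarith

end Parabolic

theorem mainTheorem2 (n : ℕ) (p : ℝ) (hp : 1 < p) (d : ℕ) (hd : 1 ≤ d)
    (hdp : Real.logb 2 9 ≤ d * p) (θ₀ φ Φ : ℤ)
    (hΦ : Parabolic.TranslationParameters p d θ₀ φ Φ)
    (c₀ δ₀ : ℝ) (hc₀ : c₀ ∈ Set.Ioo (0 : ℝ) 1) (hδ₀ : δ₀ ∈ Set.Ioo (0 : ℝ) 1) :
    ∃ α : ℝ, 0 < α ∧ ∀ E : Set ((Fin n → ℝ) × ℝ),
      Parabolic.IsWeaklyPorous p d E c₀ δ₀ Φ → Parabolic.IsImproving p d E δ₀ Φ α := by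
  have hX : 9 ≤ (2 : ℝ) ^ (d * p) := (Real.logb_le_iff_le_rpow (by norm_num) (by norm_num)).1 hdp
  have hΦ2 := hΦ.two_le_Φ
  have hΦ' : (2 : ℝ) ≤ Φ := by exact_mod_cast hΦ2
  have hc0 := hc₀.1
  obtain ⟨m, hm⟩ : ∃ m : ℕ, 1 < δ₀ * 9 ^ m := by
    obtain ⟨m, hm⟩ := pow_unbounded_of_one_lt δ₀⁻¹ (by norm_num : (1 : ℝ) < 9)
    exact ⟨m, by rwa [inv_lt_iff_one_lt_mul₀' hδ₀.1] at hm⟩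
  obtain ⟨M, hM, hF⟩ := Parabolic.Scales.exists_flow (p := p) (d := d) (c := c₀) (Φ := Φ) n m
    ⌈(2 : ℝ) ^ (d * p)⌉₊ hp hd hc₀.1 hΦ2
  set ρ : ℝ := (1 + c₀ / (Φ + 1))⁻¹ with hρ
  set B : ℝ := (((2 ^ d) ^ n * ⌈(2 : ℝ) ^ (d * p)⌉₊ : ℕ) : ℝ) ^ (M + m) with hB
  have hκ : 0 < c₀ / (Φ + 1 : ℝ) := by positivity
  have hρ1 : ρ ∈ Set.Ioo (0 : ℝ) 1 :=
    ⟨by positivity, inv_lt_one_of_one_lt₀ (by linarith)⟩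
  have hB1 : 1 < B := by
    refine one_lt_pow₀ ?_ (by omega)
    have h1 : 9 ≤ ⌈(2 : ℝ) ^ (d * p)⌉₊ := by
      exact_mod_cast hX.trans (Nat.le_ceil _)
    have h2 : 1 ≤ (2 ^ d) ^ n := Nat.one_le_pow _ _ (by positivity)
    exact_mod_cast (by nlinarith : 1 < (2 ^ d) ^ n * ⌈(2 : ℝ) ^ (d * p)⌉₊)
  have hα : 0 < -Real.log ρ / Real.log B :=
    div_pos (neg_pos.2 (Real.log_neg hρ1.1 hρ1.2)) (Real.log_pos hB1)
  refine ⟨_, hα, fun E hE => ⟨hα, (Φ + 1) * ρ⁻¹ ^ 2, ?_, fun δ hδ hδδ => ?_⟩⟩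
  · have := inv_pos.2 hρ1.1
    positivity
  · have hδ1 : δ ∈ Set.Ioo (0 : ℝ) 1 := ⟨hδ, hδδ.trans_lt hδ₀.2⟩
    rcases Parabolic.exists_division (A := Φ + 1) hρ1 hB1 (by linarith) hδ1 hc₀.1 with
      h | ⟨N, hN, hlt, hle⟩
    -- Lowering δ only weakens the size condition, so the original constant c₀ remains admissible.
    · refine ⟨c₀, hc₀, ⟨hE.1, hE.2.1, hc₀, hδ1, fun R hR => ?_⟩, h⟩
      obtain ⟨N, P, h1, h2, h3, h4, h5⟩ := hE.2.2.2.2 R hR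
      refine ⟨N, P, h1, h2, h3, fun k => le_trans ?_ (h4 k), h5⟩
      exact mul_le_mul_of_nonneg_right hδδ MeasureTheory.measureReal_nonneg
    · have himp := hE.improve hX hd hΦ2 hm hM (fun σ => hF σ E) hδ1 hN hlt
      exact ⟨_, himp.2.2.1, himp, by linarith⟩
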